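/- Let $\mathcal B$ be the Bernstein algebra of entire functions $f$ for which there are $A,B>0$ with $|f(z)|\le e^{A+B|\operatorname{Im} z|}$ for all $z\in\mathbb C$. Let $\Lambda\subset\mathbb C$ be a discrete sequence, i.e. a set with finitely many points in every disc. $\Lambda$ is called $\mathcal B$-interpolating if for every family $(v_\lambda)_{\lambda\in\Lambda}$ of complex numbers such that $\sup_{\lambda\in\Lambda}|v_\lambda|e^{-C|\operatorname{Im}\lambda|}<\infty$ for some $C>0$ there is $f\in\mathcal B$ with $f(\lambda)=v_\lambda$ for all $\lambda\in\Lambda$. Put $$n_\Lambda(z,t)=\#\bigl(\Lambda\cap\overline{D(z,t)}\bigr),\qquad N_\Lambda(z,r)=\int_0^r\frac{n_\Lambda(z,t)-n_\Lambda(z,0)}{t}\,dt+n_\Lambda(z,0)\log r .$$ Assume $\Lambda\cap\mathbb R=\emptyset$, and consider the conditions (i) there is $C>0$ such that $N_\Lambda(\lambda,|\operatorname{Im}\lambda|)\le C|\operatorname{Im}\lambda|$ for all $\lambda\in\Lambda$; (ii) $\displaystyle\sup_{x\in\mathbb R}\sum_{\lambda\in\Lambda}\frac{|\operatorname{Im}\lambda|}{|x-\lambda|^2}<\infty$.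 If $\Lambda$ lies at positive distance from the real line, i.e. there is $\delta>0$ with $|\operatorname{Im}\lambda|\ge\delta$ for all $\lambda\in\Lambda$, then $\Lambda$ is $\mathcal B$-interpolating if and only if (i) and (ii) hold. Moreover, without this additional assumption, (i) and (ii) together still imply that $\Lambda$ is $\mathcal B$-interpolating, and every $\mathcal B$-interpolating $\Lambda$ satisfies (i). -/

import Mathlib

open MeasureTheory

noncomputable section

namespace BernsteinAlgebra

/-- The Bernstein algebra: entire functions `f` with `log |f z| ≤ A + B |Im z|` on `ℂ` for some
`A, B > 0` (written in exponentiated form, so that zeros of `f` need no convention). -/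
def bernstein : Set (ℂ → ℂ) :=
  {f | Differentiable ℂ f ∧
    ∃ A > (0 : ℝ), ∃ B > (0 : ℝ), ∀ z : ℂ, ‖f z‖ ≤ Real.exp (A + B * |z.im|)}

/-- Discrete sequences in `ℂ` (finite or infinite): sets with finitely many points in each disc. -/
def IsDiscreteSeq (Λ : Set ℂ) : Prop :=
  ∀ (z : ℂ) (r : ℝ), (Λ ∩ Metric.closedBall z r).Finite

/-- Interpolation sequences for the Bernstein algebra. -/
def IsInterpolating (Λ : Set ℂ) : Prop :=
  ∀ v : Λ → ℂ,
    (∃ C > (0 : ℝ), BddAbove (Set.range fun l : Λ => ‖v l‖ * Real.exp (-C * |(l : ℂ).im|))) →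
    ∃ f ∈ bernstein, ∀ l : Λ, f l = v l

/-- The counting function `n_Λ(z, t) = #(Λ ∩ closed disc (z, t))`. -/
def countingFn (Λ : Set ℂ) (z : ℂ) (t : ℝ) : ℕ :=
  (Λ ∩ Metric.closedBall z t).ncard

/-- The integrated counting function `N_Λ(z, r)`. -/
def integratedCountingFn (Λ : Set ℂ) (z : ℂ) (r : ℝ) : ℝ :=
  (∫ t in (0 : ℝ)..r, ((countingFn Λ z t : ℝ) - (countingFn Λ z 0 : ℝ)) / t)
    + (countingFn Λ z 0 : ℝ) * Real.log r

/-- `N_Λ(l, |Im l|) ≤ C |Im l|` on `Λ`, for some `C > 0`. -/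
def DensityCondition (Λ : Set ℂ) : Prop :=
  ∃ C > (0 : ℝ), ∀ l ∈ Λ, integratedCountingFn Λ l |l.im| ≤ C * |l.im|

/-- Bounded Poisson balayage: `sup_{x ∈ ℝ} ∑_{l ∈ Λ} |Im l| / |x - l|² < ∞`. -/
def CarlesonCondition (Λ : Set ℂ) : Prop :=
  (⨆ x : ℝ, ∑' l : Λ, ENNReal.ofReal (|(l : ℂ).im| / ‖(x : ℂ) - (l : ℂ)‖ ^ 2)) < ⊤

end BernsteinAlgebra

end

namespace BernsteinAlgebra

open Filter Topology Complex
open scoped ComplexConjugate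

/-! Necessity. By the Baire category theorem, bounded data on an interpolating `Λ` are
interpolated by functions with a common bound `exp (A + B |Im z|)`. Jensen's inequality in the
disc of centre `l` and radius `|Im l|`, for a function equal to `1` at `l` and `0` elsewhere on
`Λ`, gives the density condition. If `Λ` keeps away from `ℝ`, there are also such functions equal
to `1` at a prescribed `x ∈ ℝ` and `0` on `Λ`; dividing out their zeros in a half-plane by
Blaschke factors and applying the Phragmén–Lindelöf principle gives the Carleson condition.

Sufficiency. Let `T ⊆ Λ` be finite. Its Poisson balayage onto `ℝ` has density at most `M / π`,
hence mass at most `1` between consecutive zeros of `sin (M z)`, and can be discretised by unit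
atoms at some of these zeros. Replacing them by the points of `T` turns `sin (M z)` into a
function `E` vanishing on `T`. The quotient of `∏ (z - w)` over `T`, with all `w` reflected out of
the half-plane of `z`, by the product over the atoms has bounded argument, so the Schwarz–Pick
lemma bounds the ratio of its moduli at two points. The density condition bounds the remaining
Blaschke product from below. Doing this for `T` without one point `l` gives functions peaking at
`l`, which powers of `sin z / z` and `exp (± i k z)` make to decay fast enough for an
interpolation sum bounded independently of `T`; a limit along an ultrafilter on the finite `T`
interpolates on `Λ`. -/

/-! ### Entire functions -/

theorem differentiable_dslope {f : ℂ → ℂ} (hf : Differentiable ℂ f) (c : ℂ) :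
    Differentiable ℂ (dslope f c) := by
  rw [← differentiableOn_univ, Complex.differentiableOn_dslope univ_mem]
  exact hf.differentiableOn

theorem eq_sub_mul_dslope {f : ℂ → ℂ} {c : ℂ} (hc : f c = 0) (z : ℂ) :
    f z = (z - c) * dslope f c z := by
  simpa [hc] using (sub_smul_dslope f c z).symm

theorem exists_eq_mul_prod_sub {ι : Type*} {s : Finset ι} {a : ι → ℂ} (ha : Set.InjOn a s)
    {f : ℂ → ℂ} (hf : Differentiable ℂ f) (h0 : ∀ i ∈ s, f (a i) = 0) :
    ∃ q : ℂ → ℂ, Differentiable ℂ q ∧ ∀ z, f z = q z * ∏ i ∈ s, (z - a i) := by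
  classical
  induction s using Finset.induction_on with
  | empty => exact ⟨f, hf, by simp⟩
  | insert j s hj ih =>
    obtain ⟨q, hq, hfq⟩ := ih (ha.mono (by simp)) fun i hi => h0 i (Finset.mem_insert_of_mem hi)
    have hqj : q (a j) = 0 := by
      have hfj := h0 j (Finset.mem_insert_self j s)
      rw [hfq] at hfj
      refine (mul_eq_zero.1 hfj).resolve_right (Finset.prod_ne_zero_iff.2 fun i hi h => hj ?_)
      rwa [ha (Finset.mem_insert_self j s) (Finset.mem_insert_of_mem hi) (sub_eq_zero.1 h)]
    refine ⟨dslope q (a j), differentiable_dslope hq _, fun z => ?_⟩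
    rw [hfq, Finset.prod_insert hj, eq_sub_mul_dslope hqj z]
    ring

theorem dist_le_of_norm_le_on_ball {f : ℂ → ℂ} {c z : ℂ} {K R : ℝ}
    (hf : DifferentiableOn ℂ f (Metric.ball c R)) (hK : ∀ w ∈ Metric.ball c R, ‖f w‖ ≤ K)
    (hz : z ∈ Metric.ball c R) : dist (f z) (f c) ≤ 2 * K / R * dist z c := by
  refine Complex.dist_le_div_mul_dist_of_mapsTo_ball hf (fun w hw => ?_) hz
  have hc := hK c (Metric.mem_ball_self (Metric.pos_of_mem_ball hw))
  rw [Metric.mem_closedBall]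
  linarith [dist_le_norm_add_norm (f w) (f c), hK w hw]

theorem equicontinuous_of_norm_le {ι : Type*} {f : ι → ℂ → ℂ} {M : ℂ → ℝ} (hM : Continuous M)
    (hf : ∀ i, Differentiable ℂ (f i)) (hfM : ∀ i z, ‖f i z‖ ≤ M z) : Equicontinuous f := by
  intro c
  obtain ⟨R, hR, hMR⟩ := Metric.mem_nhds_iff.1
    (hM.continuousAt.eventually_le_const (lt_add_one (M c)))
  refine Metric.equicontinuousAt_of_continuity_modulus
    (fun z => 2 * (M c + 1) / R * dist z c) ?_ f ?_
  · have : Continuous fun z : ℂ => 2 * (M c + 1) / R * dist z c := by fun_prop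
    simpa using this.tendsto c
  · filter_upwards [Metric.ball_mem_nhds c hR] with z hz i
    rw [dist_comm]
    exact dist_le_of_norm_le_on_ball (hf i).differentiableOn
      (fun w hw => (hfM i w).trans (hMR hw)) hz

theorem exists_tendsto_ultrafilter_of_norm_le {ι : Type*} (U : Ultrafilter ι) {f : ι → ℂ → ℂ}
    {M : ℂ → ℝ} (hM : Continuous M) (hf : ∀ i, Differentiable ℂ (f i))
    (hfM : ∀ i z, ‖f i z‖ ≤ M z) :
    ∃ g, Differentiable ℂ g ∧ (∀ z, ‖g z‖ ≤ M z) ∧ ∀ z, Tendsto (f · z) U (𝓝 (g z)) := by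
  have hlim : ∀ z, ∃ y ∈ Metric.closedBall (0 : ℂ) (M z), Tendsto (f · z) U (𝓝 y) := fun z =>
    (isCompact_closedBall (0 : ℂ) (M z)).ultrafilter_le_nhds (U.map (f · z))
      (tendsto_principal.2 (Eventually.of_forall fun i => by simpa using hfM i z))
  choose g hgM hg using hlim
  have hunif := (EquicontinuousOn.tendsto_uniformOnFun_iff_pi (𝔖 := {K : Set ℂ | IsCompact K})
    (fun K hK => hK) (Set.eq_univ_of_forall fun z => ⟨{z}, isCompact_singleton, rfl⟩)
    (fun K _ => (equicontinuous_of_norm_le hM hf hfM).equicontinuousOn K) (U : Filter ι) g).2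
    (tendsto_pi_nhds.2 hg)
  rw [UniformOnFun.tendsto_iff_tendstoUniformlyOn] at hunif
  have hloc : TendstoLocallyUniformlyOn f g U Set.univ :=
    (tendstoLocallyUniformlyOn_iff_forall_isCompact isOpen_univ).2 fun K _ hK => hunif K hK
  exact ⟨g, differentiableOn_univ.1 (hloc.differentiableOn
    (Eventually.of_forall fun i => (hf i).differentiableOn) isOpen_univ),
    fun z => by simpa using hgM z, hg⟩

theorem norm_exp_mul_I_le (w : ℂ) : ‖Complex.exp (w * I)‖ ≤ Real.exp |w.im| := by
  rw [Complex.norm_exp]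
  simpa using neg_le_abs w.im

theorem norm_sin_le (w : ℂ) : ‖Complex.sin w‖ ≤ Real.exp |w.im| := by
  have hneg := norm_exp_mul_I_le (-w)
  rw [neg_im, abs_neg] at hneg
  rw [Complex.sin, norm_div, norm_mul, norm_I, mul_one, Complex.norm_ofNat]
  linarith [norm_exp_mul_I_le w, norm_sub_le (Complex.exp (-w * I)) (Complex.exp (w * I))]

theorem norm_cos_le (w : ℂ) : ‖Complex.cos w‖ ≤ Real.exp |w.im| := by
  have hneg := norm_exp_mul_I_le (-w)
  rw [neg_im, abs_neg] at hneg
  rw [Complex.cos, norm_div, Complex.norm_ofNat]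
  linarith [norm_exp_mul_I_le w, norm_add_le (Complex.exp (w * I)) (Complex.exp (-w * I))]

/-- The entire function `sin w / w`, with value `1` at `0`. -/
noncomputable def csinc : ℂ → ℂ := dslope Complex.sin 0

theorem differentiable_csinc : Differentiable ℂ csinc :=
  differentiable_dslope Complex.differentiable_sin 0

theorem csinc_zero : csinc 0 = 1 := by simp [csinc, dslope_same]

theorem sin_eq_mul_csinc (w : ℂ) : Complex.sin w = w * csinc w := by
  simpa [csinc] using eq_sub_mul_dslope Complex.sin_zero w

theorem norm_csinc_le (w : ℂ) : ‖csinc w‖ ≤ Real.exp |w.im| := by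
  rcases eq_or_ne w 0 with rfl | hw
  · simp [csinc_zero]
  have hmvt := ((convex_Icc (-|w.im|) |w.im|).linear_preimage
    Complex.imLm).norm_image_sub_le_of_norm_deriv_le (f := Complex.sin) (C := Real.exp |w.im|)
    (x := 0) (y := w) (fun z _ => Complex.differentiable_sin z)
    (fun z hz => by
      rw [Complex.deriv_sin]
      exact (norm_cos_le z).trans (Real.exp_le_exp.2 (abs_le.2 hz)))
    (abs_le.1 (by simp)) (abs_le.1 le_rfl)
  rw [Complex.sin_zero, sub_zero, sub_zero, sin_eq_mul_csinc, norm_mul, mul_comm] at hmvt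
  exact le_of_mul_le_mul_right hmvt (norm_pos_iff.2 hw)

theorem norm_csinc_mul_one_add_le (w : ℂ) : ‖csinc w‖ * (1 + ‖w‖) ≤ 2 * Real.exp |w.im| := by
  have hsin := norm_sin_le w
  rw [sin_eq_mul_csinc, norm_mul] at hsin
  linarith [norm_csinc_le w]

theorem norm_le_of_imaginary_axis {F : ℂ → ℂ} {M : ℝ}
    (hd : DiffContOnCl ℂ F {z | 0 < z.re})
    (hF : F =O[Bornology.cobounded ℂ ⊓ 𝓟 {z | 0 < z.re}] fun _ => (1 : ℝ))
    (hM : ∀ x : ℝ, ‖F (x * I)‖ ≤ M) {z : ℂ} (hz : 0 ≤ z.re) : ‖F z‖ ≤ M := by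
  refine PhragmenLindelof.right_half_plane_of_bounded_on_real hd
    ⟨1, by norm_num, 0, by simpa using hF⟩ ?_ hM hz
  have hray : Tendsto (fun x : ℝ => (x : ℂ)) atTop
      (Bornology.cobounded ℂ ⊓ 𝓟 {z | 0 < z.re}) := by
    refine tendsto_inf.2 ⟨?_, tendsto_principal.2 ?_⟩
    · simpa [← tendsto_norm_atTop_iff_cobounded] using tendsto_abs_atTop_atTop
    · filter_upwards [eventually_gt_atTop 0] with x hx
      simpa using hx
  exact (Asymptotics.isBigO_one_iff ℝ).1 (hF.comp_tendsto hray)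

theorem norm_le_mul_exp_im {f : ℂ → ℂ} {B M : ℝ} (hf : Differentiable ℂ f)
    (hO : f =O[Bornology.cobounded ℂ ⊓ 𝓟 {z | 0 ≤ z.im}] fun z => Real.exp (B * z.im))
    (hM : ∀ x : ℝ, ‖f x‖ ≤ M) {z : ℂ} (hz : 0 ≤ z.im) : ‖f z‖ ≤ M * Real.exp (B * z.im) := by
  have hrot : Tendsto (fun ζ : ℂ => ζ * I) (Bornology.cobounded ℂ ⊓ 𝓟 {ζ | 0 < ζ.re})
      (Bornology.cobounded ℂ ⊓ 𝓟 {z | 0 ≤ z.im}) :=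
    (tendsto_mul_right_cobounded I_ne_zero).inf
      (tendsto_principal_principal.2 fun ζ hζ => by simpa using (Set.mem_ofPred.1 hζ).le)
  have hexp : ∀ ζ : ℂ, ‖Complex.exp (-B * ζ)‖ = Real.exp (-(B * ζ.re)) := fun ζ => by
    simp [Complex.norm_exp]
  have hbound := norm_le_of_imaginary_axis (F := fun ζ => f (ζ * I) * Complex.exp (-B * ζ))
    (M := M) (z := -(z * I)) (Differentiable.diffContOnCl (by fun_prop)) ?_ (fun x => ?_)
    (by simpa using hz)
  · rw [norm_mul, hexp, Real.exp_neg, ← div_eq_mul_inv, div_le_iff₀ (Real.exp_pos _)] at hbound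
    simpa [mul_assoc] using hbound
  · refine ((hO.comp_tendsto hrot).mul (g₂ := fun ζ => Real.exp (-(B * ζ.re)))
      (Asymptotics.isBigO_of_le _ fun ζ => ?_)).congr_right fun ζ => ?_
    · rw [hexp, Real.norm_of_nonneg (Real.exp_pos _).le]
    · simp [← Real.exp_add]
  · simpa [Complex.norm_exp, mul_assoc] using hM (-x)

/-! ### Jensen's inequality -/

theorem norm_sq_sub_mul_conj {c z w : ℂ} {R : ℝ} (hz : ‖z - c‖ = R) :
    ‖(R : ℂ) ^ 2 - (z - c) * conj (w - c)‖ = R * ‖z - w‖ := by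
  rw [show (R : ℂ) ^ 2 = (z - c) * conj (z - c) by rw [mul_conj, normSq_eq_norm_sq, hz]; simp,
    ← mul_sub, ← map_sub, sub_sub_sub_cancel_right, norm_mul, hz, Complex.norm_conj]

theorem norm_mul_pow_card_le_mul_prod_dist {ι : Type*} {s : Finset ι} {a : ι → ℂ}
    (ha : Set.InjOn a s) {c : ℂ} {R M : ℝ} (hR : 0 < R) {f : ℂ → ℂ} (hf : Differentiable ℂ f)
    (h0 : ∀ i ∈ s, f (a i) = 0) (hM : ∀ z, ‖z - c‖ = R → ‖f z‖ ≤ M) :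
    ‖f c‖ * R ^ s.card ≤ M * ∏ i ∈ s, ‖c - a i‖ := by
  obtain ⟨q, hq, hfq⟩ := exists_eq_mul_prod_sub ha hf h0
  have hmax := Complex.norm_le_of_forall_mem_frontier_norm_le (C := M)
    (f := fun z => q z * ∏ i ∈ s, ((R : ℂ) ^ 2 - (z - c) * conj (a i - c)) / R)
    (Metric.isBounded_ball (x := c) (r := R)) (Differentiable.diffContOnCl (by fun_prop))
    (fun z hz => ?_) (subset_closure (Metric.mem_ball_self hR))
  · have hc : ‖q c‖ * R ^ s.card ≤ M := by
      simpa [norm_prod, abs_of_pos hR, pow_two, hR.ne'] using hmax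
    calc ‖f c‖ * R ^ s.card = ‖q c‖ * R ^ s.card * ∏ i ∈ s, ‖c - a i‖ := by
          rw [hfq, norm_mul, norm_prod]; ring
      _ ≤ M * ∏ i ∈ s, ‖c - a i‖ := by gcongr
  · rw [frontier_ball c hR.ne', mem_sphere_iff_norm] at hz
    have hblaschke : ∀ i, ‖((R : ℂ) ^ 2 - (z - c) * conj (a i - c)) / R‖ = ‖z - a i‖ := fun i => by
      rw [norm_div, norm_sq_sub_mul_conj hz, norm_real, Real.norm_of_nonneg hR.le,
        mul_div_cancel_left₀ _ hR.ne']
    simpa only [norm_mul, norm_prod, hblaschke, hfq] using hM z hz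

theorem isBigO_sub_sub_cobounded (a b : ℂ) :
    (fun z => z - a) =O[Bornology.cobounded ℂ] fun z => z - b := by
  have hb : Tendsto (norm ∘ fun z => z - b) (Bornology.cobounded ℂ) atTop :=
    tendsto_norm_cobounded_atTop.comp (tendsto_sub_const_cobounded b)
  exact ((Asymptotics.isBigO_refl (fun z => z - b) _).add
    (Asymptotics.isLittleO_const_left.2 (.inr hb)).isBigO).congr_left
      fun z => sub_add_sub_cancel z b a

theorem norm_mul_prod_norm_sub_conj_le {ι : Type*} {s : Finset ι} {a : ι → ℂ}
    (ha : Set.InjOn a s) {B M : ℝ} {f : ℂ → ℂ} (hf : Differentiable ℂ f)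
    (h0 : ∀ i ∈ s, f (a i) = 0)
    (hO : f =O[Bornology.cobounded ℂ ⊓ 𝓟 {z | 0 ≤ z.im}] fun z => Real.exp (B * z.im))
    (hM : ∀ x : ℝ, ‖f x‖ ≤ M) {z : ℂ} (hz : 0 ≤ z.im) :
    ‖f z‖ * ∏ i ∈ s, ‖z - conj (a i)‖ ≤ M * Real.exp (B * z.im) * ∏ i ∈ s, ‖z - a i‖ := by
  obtain ⟨q, hq, hfq⟩ := exists_eq_mul_prod_sub ha hf h0
  have hPL := norm_le_mul_exp_im (f := fun z => q z * ∏ i ∈ s, (z - conj (a i))) (B := B) (M := M)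
    (by fun_prop) ?_ (fun x => ?_) hz
  · rw [norm_mul, norm_prod] at hPL
    calc ‖f z‖ * ∏ i ∈ s, ‖z - conj (a i)‖
        = ‖q z‖ * (∏ i ∈ s, ‖z - conj (a i)‖) * ∏ i ∈ s, ‖z - a i‖ := by
          rw [hfq, norm_mul, norm_prod]; ring
      _ ≤ M * Real.exp (B * z.im) * ∏ i ∈ s, ‖z - a i‖ := by gcongr
  · refine (((Asymptotics.isBigO_refl q _).mul ((Asymptotics.IsBigO.finsetProd fun i _ =>
      isBigO_sub_sub_cobounded (conj (a i)) (a i)).mono inf_le_left)).congr_right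
      fun z => (hfq z).symm).trans hO
  · have hreal : ∀ i, ‖(x : ℂ) - conj (a i)‖ = ‖(x : ℂ) - a i‖ := fun i => by
      rw [← Complex.norm_conj]; simp
    simpa only [norm_mul, norm_prod, hreal, hfq] using hM x

/-! ### Necessity of the two conditions -/

/-- Membership in the Bernstein algebra with prescribed constants: `log |f z| ≤ A + B |Im z|`. -/
def HasBernsteinBound (A B : ℝ) (f : ℂ → ℂ) : Prop :=
  Differentiable ℂ f ∧ ∀ z : ℂ, ‖f z‖ ≤ Real.exp (A + B * |z.im|)

namespace HasBernsteinBound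

variable {A B : ℝ} {f : ℂ → ℂ}

theorem mono {A' B' : ℝ} (hf : HasBernsteinBound A B f) (hA : A ≤ A') (hB : B ≤ B') :
    HasBernsteinBound A' B' f :=
  ⟨hf.1, fun z => (hf.2 z).trans (by gcongr)⟩

theorem of_norm_le {K : ℝ} (hK : 0 < K) (hf : Differentiable ℂ f)
    (hfK : ∀ z, ‖f z‖ ≤ K * Real.exp (B * |z.im|)) : HasBernsteinBound (Real.log K) B f :=
  ⟨hf, fun z => by rw [Real.exp_add, Real.exp_log hK]; exact hfK z⟩

theorem mem_bernstein (hf : HasBernsteinBound A B f) : f ∈ bernstein := by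
  obtain ⟨hd, hle⟩ := hf.mono (le_max_left A 1) (le_max_left B 1)
  exact ⟨hd, max A 1, by positivity, max B 1, by positivity, hle⟩

theorem comp_neg (hf : HasBernsteinBound A B f) : HasBernsteinBound A B fun z => f (-z) :=
  ⟨hf.1.comp differentiable_neg, fun z => by simpa using hf.2 (-z)⟩

theorem norm_ofReal_le (hf : HasBernsteinBound A B f) (x : ℝ) : ‖f x‖ ≤ Real.exp A := by
  simpa using hf.2 x

theorem isBigO_exp_im (hf : HasBernsteinBound A B f) :
    f =O[Bornology.cobounded ℂ ⊓ 𝓟 {z | 0 ≤ z.im}] fun z => Real.exp (B * z.im) := by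
  refine Asymptotics.IsBigO.of_bound (Real.exp A) ?_
  filter_upwards [mem_inf_of_right (mem_principal_self {z : ℂ | 0 ≤ z.im})] with z hz
  rw [Real.norm_of_nonneg (Real.exp_pos _).le, ← Real.exp_add]
  simpa [abs_of_nonneg hz] using hf.2 z

theorem exists_tendsto_ultrafilter {ι : Type*} (U : Ultrafilter ι) {f : ι → ℂ → ℂ}
    (hf : ∀ i, HasBernsteinBound A B (f i)) :
    ∃ g, HasBernsteinBound A B g ∧ ∀ z, Tendsto (f · z) U (𝓝 (g z)) := by
  obtain ⟨g, hg, hgM, hlim⟩ := exists_tendsto_ultrafilter_of_norm_le U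
    (M := fun z => Real.exp (A + B * |z.im|)) (by fun_prop) (fun i => (hf i).1) fun i => (hf i).2
  exact ⟨g, ⟨hg, hgM⟩, hlim⟩

end HasBernsteinBound

/-- The bounded sequences on `Λ` that are interpolated by a function with Bernstein constants
`n, n`; these are the closed sets of the Baire category argument. -/
def interpolatedWith (Λ : Set ℂ) (n : ℕ) : Set (lp (fun _ : Λ => ℂ) ⊤) :=
  {v | ∃ f, HasBernsteinBound n n f ∧ ∀ l : Λ, f l = v l}

theorem isClosed_interpolatedWith (Λ : Set ℂ) (n : ℕ) : IsClosed (interpolatedWith Λ n) := by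
  refine isClosed_of_closure_subset fun v hv => ?_
  have := mem_closure_iff_comap_neBot.1 hv
  let U := Ultrafilter.of (comap ((↑) : interpolatedWith Λ n → lp (fun _ : Λ => ℂ) ⊤) (𝓝 v))
  choose f hf hfu using fun u : interpolatedWith Λ n => u.2
  obtain ⟨g, hg, hlim⟩ := HasBernsteinBound.exists_tendsto_ultrafilter U hf
  refine ⟨g, hg, fun l => tendsto_nhds_unique (hlim l) ?_⟩
  have heval : Continuous fun u : lp (fun _ : Λ => ℂ) ⊤ => u l :=
    (continuous_apply l).comp (lp.uniformContinuous_coe (E := fun _ : Λ => ℂ)).continuous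
  simp only [hfu]
  exact (heval.tendsto v).comp (tendsto_comap.mono_left (Ultrafilter.of_le _))

namespace IsInterpolating

variable {Λ : Set ℂ}

theorem iUnion_interpolatedWith (h : IsInterpolating Λ) :
    ⋃ n, interpolatedWith Λ n = Set.univ := by
  refine Set.eq_univ_of_forall fun v => ?_
  obtain ⟨f, ⟨hf, A, -, B, -, hAB⟩, hfv⟩ := h (fun l => v l) ⟨1, one_pos, ‖v‖, by
    rintro _ ⟨l, rfl⟩
    have hexp : Real.exp (-1 * |(l : ℂ).im|) ≤ 1 := Real.exp_le_one_iff.2 (by simp)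
    exact (mul_le_of_le_one_right (norm_nonneg _) hexp).trans
      (lp.norm_apply_le_norm ENNReal.top_ne_zero v l)⟩
  obtain ⟨n, hn⟩ := exists_nat_ge (max A B)
  exact Set.mem_iUnion.2 ⟨n, f, HasBernsteinBound.mono ⟨hf, hAB⟩
    ((le_max_left _ _).trans hn) ((le_max_right _ _).trans hn), hfv⟩

theorem exists_uniform_bound (h : IsInterpolating Λ) :
    ∃ A B : ℝ, 0 ≤ B ∧ ∀ v : Λ → ℂ, (∀ l, ‖v l‖ ≤ 1) →
      ∃ f, HasBernsteinBound A B f ∧ ∀ l : Λ, f l = v l := by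
  obtain ⟨n, v₀, hv₀⟩ := nonempty_interior_of_iUnion_of_closed (isClosed_interpolatedWith Λ)
    h.iUnion_interpolatedWith
  obtain ⟨ε, hε, hball⟩ := Metric.mem_nhds_iff.1 (mem_interior_iff_mem_nhds.1 hv₀)
  obtain ⟨f₀, hf₀, hfv₀⟩ := hball (Metric.mem_ball_self hε)
  refine ⟨Real.log (2 / ε * (2 * Real.exp n)), n, n.cast_nonneg, fun v hv => ?_⟩
  let u : lp (fun _ : Λ => ℂ) ⊤ := ⟨v, memℓp_infty ⟨1, by rintro _ ⟨l, rfl⟩; exact hv l⟩⟩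
  have hu : ‖u‖ ≤ 1 := lp.norm_le_of_forall_le zero_le_one hv
  obtain ⟨f₁, hf₁, hfv₁⟩ := hball (a := v₀ + ((ε / 2 : ℝ) : ℂ) • u) (by
    rw [Metric.mem_ball, dist_eq_norm, add_sub_cancel_left, norm_smul, norm_real,
      Real.norm_of_nonneg (by positivity)]
    nlinarith [norm_nonneg u])
  refine ⟨fun z => ((2 / ε : ℝ) : ℂ) * (f₁ z - f₀ z), HasBernsteinBound.of_norm_le
    (by positivity) ((hf₁.1.sub hf₀.1).const_mul _) fun z => ?_, fun l => ?_⟩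
  · have hsub := (norm_sub_le (f₁ z) (f₀ z)).trans (add_le_add (hf₁.2 z) (hf₀.2 z))
    rw [norm_mul, norm_real, Real.norm_of_nonneg (by positivity), mul_assoc, mul_assoc,
      ← Real.exp_add, two_mul]
    gcongr
  · have hval : f₁ l = v₀ l + ((ε / 2 : ℝ) : ℂ) * v l := hfv₁ l
    have hscale : 2 / ε * (ε / 2) = 1 := by field_simp
    simp only [hval, hfv₀, add_sub_cancel_left]
    rw [← mul_assoc, ← ofReal_mul, hscale, ofReal_one, one_mul]

end IsInterpolating

theorem integrableOn_indicator_Ici_inv {d : ℝ} (hd : 0 < d) (r : ℝ) :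
    IntegrableOn (Set.indicator (Set.Ici d) fun t : ℝ => t⁻¹) (Set.Ioc 0 r) := by
  have h : IntegrableOn (fun t : ℝ => t⁻¹) (Set.Icc d r) :=
    (continuousOn_inv₀.mono fun t ht => (hd.trans_le ht.1).ne').integrableOn_Icc
  rw [IntegrableOn, integrable_indicator_iff measurableSet_Ici, IntegrableOn,
    Measure.restrict_restrict measurableSet_Ici]
  exact h.mono_set fun t ht => ⟨ht.1, ht.2.2⟩

theorem setIntegral_indicator_Ici_inv {d r : ℝ} (hd : 0 < d) (hdr : d ≤ r) :
    ∫ t in Set.Ioc 0 r, Set.indicator (Set.Ici d) (fun t : ℝ => t⁻¹) t = Real.log (r / d) := by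
  have hinter : Set.Ioc 0 r ∩ Set.Ici d = Set.Icc d r := by
    ext t
    exact ⟨fun h => ⟨h.2, h.1.2⟩, fun h => ⟨⟨hd.trans_le h.1, h.2⟩, h.1⟩⟩
  rw [setIntegral_indicator measurableSet_Ici, hinter, integral_Icc_eq_integral_Ioc,
    ← intervalIntegral.integral_of_le hdr, integral_inv_of_pos hd (hd.trans_le hdr)]

section CountingFunction

variable {Λ : Set ℂ} {l : ℂ}

/-- The points of `Λ` other than `l` in the closed disc of centre `l` and radius `r`. -/
noncomputable def neighbours (hΛ : IsDiscreteSeq Λ) (l : ℂ) (r : ℝ) : Finset ℂ :=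
  (hΛ l r).toFinset.erase l

theorem mem_neighbours (hΛ : IsDiscreteSeq Λ) {r : ℝ} {w : ℂ} :
    w ∈ neighbours hΛ l r ↔ w ≠ l ∧ w ∈ Λ ∧ dist w l ≤ r := by
  simp [neighbours]

theorem countingFn_zero (hl : l ∈ Λ) : countingFn Λ l 0 = 1 := by
  rw [countingFn, Metric.closedBall_zero, Set.inter_eq_right.2 (Set.singleton_subset_iff.2 hl),
    Set.ncard_singleton]

theorem countingFn_sub_one_eq_sum (hΛ : IsDiscreteSeq Λ) (hl : l ∈ Λ) {r t : ℝ} (ht : 0 ≤ t)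
    (htr : t ≤ r) :
    (countingFn Λ l t : ℝ) - 1 = ∑ w ∈ neighbours hΛ l r, if dist w l ≤ t then 1 else 0 := by
  classical
  have hmem : l ∈ (hΛ l t).toFinset := by simp [hl, ht]
  have hfilter :
      (neighbours hΛ l r).filter (fun w => dist w l ≤ t) = (hΛ l t).toFinset.erase l := by
    ext w
    rw [Finset.mem_filter, mem_neighbours, Finset.mem_erase, Set.Finite.mem_toFinset]
    exact ⟨fun h => ⟨h.1.1, h.1.2.1, h.2⟩, fun h => ⟨⟨h.1, h.2.1, h.2.2.trans htr⟩, h.2.2⟩⟩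
  rw [Finset.sum_boole, hfilter, Finset.card_erase_of_mem hmem, countingFn,
    Set.ncard_eq_toFinset_card _ (hΛ l t), Nat.cast_sub (Finset.card_pos.2 ⟨l, hmem⟩),
    Nat.cast_one]

theorem integratedCountingFn_eq_sum_log (hΛ : IsDiscreteSeq Λ) (hl : l ∈ Λ) {r : ℝ}
    (hr : 0 < r) : integratedCountingFn Λ l r =
      ∑ w ∈ neighbours hΛ l r, Real.log (r / dist w l) + Real.log r := by
  have hd : ∀ w ∈ neighbours hΛ l r, 0 < dist w l ∧ dist w l ≤ r := fun w hw =>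
    ⟨dist_pos.2 ((mem_neighbours hΛ).1 hw).1, ((mem_neighbours hΛ).1 hw).2.2⟩
  have hintegrand : Set.EqOn (fun t => ((countingFn Λ l t : ℝ) - (1 : ℕ)) / t)
      (fun t => ∑ w ∈ neighbours hΛ l r, Set.indicator (Set.Ici (dist w l)) (fun t : ℝ => t⁻¹) t)
      (Set.Ioc 0 r) := fun t ht => by
    simp only [Nat.cast_one]
    rw [countingFn_sub_one_eq_sum hΛ hl ht.1.le ht.2, Finset.sum_div]
    refine Finset.sum_congr rfl fun w _ => ?_
    by_cases h : dist w l ≤ t <;> simp [h, Set.indicator]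
  rw [integratedCountingFn, countingFn_zero hl, intervalIntegral.integral_of_le hr.le,
    setIntegral_congr_fun measurableSet_Ioc hintegrand,
    integral_finsetSum _ fun w hw => integrableOn_indicator_Ici_inv (hd w hw).1 r,
    Finset.sum_congr rfl fun w hw => setIntegral_indicator_Ici_inv (hd w hw).1 (hd w hw).2,
    Nat.cast_one, one_mul]

end CountingFunction

theorem log_add_le_exp_mul {r : ℝ} (hr : 0 < r) (A : ℝ) :
    Real.log r + A ≤ Real.exp A * r := by
  have h := Real.log_le_self (x := Real.exp A * r) (by positivity)
  rwa [Real.log_mul (Real.exp_pos A).ne' hr.ne', Real.log_exp, add_comm] at h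

theorem IsInterpolating.densityCondition {Λ : Set ℂ} (hΛ : IsDiscreteSeq Λ)
    (hreal : ∀ l ∈ Λ, l.im ≠ 0) (h : IsInterpolating Λ) : DensityCondition Λ := by
  classical
  obtain ⟨A, B, hB, hAB⟩ := h.exists_uniform_bound
  refine ⟨2 * B + Real.exp A, by positivity, fun l hl => ?_⟩
  set r := |l.im|
  have hr : 0 < r := abs_pos.2 (hreal l hl)
  have hd : ∀ w ∈ neighbours hΛ l r, 0 < dist w l := fun w hw =>
    dist_pos.2 ((mem_neighbours hΛ).1 hw).1
  obtain ⟨f, hf, hfv⟩ := hAB (Pi.single ⟨l, hl⟩ 1) fun w => by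
    rw [Pi.single_apply]; split_ifs <;> simp
  have hfl : f l = 1 := by simpa using hfv ⟨l, hl⟩
  have hcircle : ∀ z, ‖z - l‖ = r → ‖f z‖ ≤ Real.exp (A + B * (2 * r)) := fun z hz => by
    have hzr := (abs_sub_abs_le_abs_sub z.im l.im).trans (hz ▸ abs_im_le_norm (z - l))
    exact (hf.2 z).trans (by gcongr; linarith)
  have hJensen : ∏ w ∈ neighbours hΛ l r, r / dist w l ≤ Real.exp (A + B * (2 * r)) := by
    have hle := norm_mul_pow_card_le_mul_prod_dist (s := neighbours hΛ l r) (a := id)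
      (Set.injOn_id _) hr hf.1 (fun w hw => by
        obtain ⟨hwl, hw, -⟩ := (mem_neighbours hΛ).1 hw
        simpa [hwl] using hfv ⟨w, hw⟩) hcircle
    rw [Finset.prod_div_distrib, Finset.prod_const, div_le_iff₀ (Finset.prod_pos hd)]
    simpa [hfl, dist_eq_norm, norm_sub_rev] using hle
  have hquot : ∀ w ∈ neighbours hΛ l r, 0 < r / dist w l := fun w hw => div_pos hr (hd w hw)
  have hlog := Real.log_le_log (Finset.prod_pos hquot) hJensen
  rw [Real.log_prod fun w hw => (hquot w hw).ne', Real.log_exp] at hlog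
  rw [integratedCountingFn_eq_sum_log hΛ hl hr]
  linarith [log_add_le_exp_mul hr A]

theorem norm_sub_conj_sq (z w : ℂ) :
    ‖z - conj w‖ ^ 2 = ‖z - w‖ ^ 2 + 4 * z.im * w.im := by
  simp only [Complex.sq_norm, normSq_apply, sub_re, sub_im, conj_re, conj_im]
  ring

theorem two_mul_im_mul_im_div_le_log {z w : ℂ} (hzw : z ≠ w) (hzw' : z ≠ conj w) :
    2 * z.im * w.im / ‖z - conj w‖ ^ 2 ≤ Real.log (‖z - conj w‖ / ‖z - w‖) := by
  have hN : 0 < ‖z - w‖ ^ 2 := by have := norm_pos_iff.2 (sub_ne_zero.2 hzw); positivity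
  have hP : 0 < ‖z - conj w‖ ^ 2 := by have := norm_pos_iff.2 (sub_ne_zero.2 hzw'); positivity
  have hsq : Real.log (‖z - conj w‖ ^ 2 / ‖z - w‖ ^ 2) =
      2 * Real.log (‖z - conj w‖ / ‖z - w‖) := by rw [← div_pow, Real.log_pow, Nat.cast_ofNat]
  have hlog := Real.one_sub_inv_le_log_of_pos (div_pos hP hN)
  have hfrac : 1 - (‖z - conj w‖ ^ 2 / ‖z - w‖ ^ 2)⁻¹ =
      2 * (2 * z.im * w.im / ‖z - conj w‖ ^ 2) := by
    rw [inv_div, one_sub_div hP.ne', norm_sub_conj_sq]; ring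
  linarith

theorem ne_conj_of_im_pos {z w : ℂ} (hz : 0 < z.im) (hw : 0 < w.im) : z ≠ conj w := fun h => by
  have := congrArg Complex.im h
  rw [conj_im] at this
  linarith

namespace HasBernsteinBound

variable {A B : ℝ} {f : ℂ → ℂ} {ι : Type*} {s : Finset ι} {a : ι → ℂ}

theorem sum_im_mul_im_div_le (hf : HasBernsteinBound A B f) (ha : Set.InjOn a s)
    (hs : ∀ i ∈ s, 0 < (a i).im) (h0 : ∀ i ∈ s, f (a i) = 0) {z : ℂ} (hz : 0 < z.im)
    (hfz : f z ≠ 0) :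
    ∑ i ∈ s, 2 * z.im * (a i).im / ‖z - conj (a i)‖ ^ 2 ≤
      A + B * z.im - Real.log ‖f z‖ := by
  have hne : ∀ i ∈ s, z ≠ a i := fun i hi h => hfz (h ▸ h0 i hi)
  have hne' : ∀ i ∈ s, z ≠ conj (a i) := fun i hi => ne_conj_of_im_pos hz (hs i hi)
  have hpos : ∀ i ∈ s, 0 < ‖z - a i‖ := fun i hi => norm_pos_iff.2 (sub_ne_zero.2 (hne i hi))
  have hquot : ∀ i ∈ s, 0 < ‖z - conj (a i)‖ / ‖z - a i‖ := fun i hi =>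
    div_pos (norm_pos_iff.2 (sub_ne_zero.2 (hne' i hi))) (hpos i hi)
  have hJensen : ‖f z‖ * ∏ i ∈ s, ‖z - conj (a i)‖ / ‖z - a i‖ ≤ Real.exp (A + B * z.im) := by
    rw [Finset.prod_div_distrib, mul_div_assoc', div_le_iff₀ (Finset.prod_pos hpos), Real.exp_add]
    exact norm_mul_prod_norm_sub_conj_le ha hf.1 h0 hf.isBigO_exp_im hf.norm_ofReal_le hz.le
  have hfz' : 0 < ‖f z‖ := norm_pos_iff.2 hfz
  have hlog := Real.log_le_log (mul_pos hfz' (Finset.prod_pos hquot)) hJensen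
  rw [Real.log_mul hfz'.ne' (Finset.prod_pos hquot).ne',
    Real.log_prod fun i hi => (hquot i hi).ne', Real.log_exp] at hlog
  have hsum := Finset.sum_le_sum fun i hi => two_mul_im_mul_im_div_le_log (hne i hi) (hne' i hi)
  linarith

theorem half_le_norm_add_mul_I (hf : HasBernsteinBound A B f) (hB : 0 ≤ B) {x ε : ℝ}
    (hfx : f x = 1) (hε : 0 ≤ ε) (hεAB : 4 * ε * Real.exp (A + B) ≤ 1) :
    1 / 2 ≤ ‖f (x + ε * I)‖ := by
  have hdist : dist (x + ε * I : ℂ) x = ε := by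
    rw [dist_eq_norm, add_sub_cancel_left, norm_mul, norm_I, norm_real, mul_one,
      Real.norm_of_nonneg hε]
  have hA : 1 ≤ Real.exp (A + B) := by
    have hfx' := hf.norm_ofReal_le x
    rw [hfx, norm_one] at hfx'
    exact hfx'.trans (Real.exp_le_exp.2 (le_add_of_nonneg_right hB))
  have hball : ∀ w ∈ Metric.ball (x : ℂ) 1, ‖f w‖ ≤ Real.exp (A + B) := fun w hw => by
    have hw' : |w.im| ≤ 1 := by
      simpa using (abs_im_le_norm (w - x)).trans (mem_ball_iff_norm.1 hw).le
    exact (hf.2 w).trans (Real.exp_le_exp.2 (by nlinarith))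
  have hSchwarz := dist_le_of_norm_le_on_ball hf.1.differentiableOn hball
    (z := x + ε * I) (by rw [Metric.mem_ball, hdist]; nlinarith)
  rw [hdist, hfx, div_one, dist_comm, dist_eq_norm] at hSchwarz
  have htri := norm_sub_norm_le (1 : ℂ) (f (x + ε * I))
  rw [norm_one] at htri
  linarith

theorem sum_im_div_le (hf : HasBernsteinBound A B f) (hB : 0 ≤ B) (ha : Set.InjOn a s) {x ε : ℝ}
    (hfx : f x = 1) (hε : 0 < ε) (hεAB : 4 * ε * Real.exp (A + B) ≤ 1)
    (hs : ∀ i ∈ s, ε ≤ (a i).im) (h0 : ∀ i ∈ s, f (a i) = 0) :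
    ∑ i ∈ s, (a i).im / ‖(x : ℂ) - a i‖ ^ 2 ≤ 2 / ε * (A + B * ε + Real.log 2) := by
  set z : ℂ := x + ε * I with hz
  have hzim : z.im = ε := by simp [hz]
  have hfz : 1 / 2 ≤ ‖f z‖ := hf.half_le_norm_add_mul_I hB hfx hε.le hεAB
  have hpos : ∀ i ∈ s, 0 < (a i).im := fun i hi => hε.trans_le (hs i hi)
  have hterm : ∀ i ∈ s, ε / 2 * ((a i).im / ‖(x : ℂ) - a i‖ ^ 2) ≤
      2 * z.im * (a i).im / ‖z - conj (a i)‖ ^ 2 := fun i hi => by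
    have him : (a i).im ≤ ‖(x : ℂ) - a i‖ := by
      simpa [abs_of_pos (hpos i hi)] using abs_im_le_norm ((x : ℂ) - a i)
    have hle : ‖z - conj (a i)‖ ≤ 2 * ‖(x : ℂ) - a i‖ := by
      have hconj : ‖(x : ℂ) - conj (a i)‖ = ‖(x : ℂ) - a i‖ := by
        rw [← Complex.norm_conj]; simp
      have htri := norm_add_le ((x : ℂ) - conj (a i)) (ε * I)
      rw [hconj, norm_mul, norm_I, norm_real, mul_one, Real.norm_of_nonneg hε.le,
        sub_add_eq_add_sub, ← hz] at htri
      linarith [hs i hi]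
    have hden : 0 < ‖z - conj (a i)‖ := norm_pos_iff.2
      (sub_ne_zero.2 (ne_conj_of_im_pos (hzim ▸ hε) (hpos i hi)))
    calc ε / 2 * ((a i).im / ‖(x : ℂ) - a i‖ ^ 2)
        = 2 * ε * (a i).im / (2 * ‖(x : ℂ) - a i‖) ^ 2 := by ring
      _ ≤ 2 * z.im * (a i).im / ‖z - conj (a i)‖ ^ 2 := by
        have := hpos i hi
        rw [hzim]
        gcongr
  have hsum := (Finset.sum_le_sum hterm).trans (hf.sum_im_mul_im_div_le ha hpos h0
    (hzim ▸ hε) (norm_pos_iff.1 (one_half_pos.trans_le hfz)))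
  have hlog := Real.log_le_log one_half_pos hfz
  rw [one_div, Real.log_inv] at hlog
  rw [← Finset.mul_sum, hzim] at hsum
  rw [div_mul_eq_mul_div, le_div_iff₀ hε]
  linarith

theorem sum_abs_im_div_le (hf : HasBernsteinBound A B f) (hB : 0 ≤ B) (ha : Set.InjOn a s)
    {x ε : ℝ} (hfx : f x = 1) (hε : 0 < ε) (hεAB : 4 * ε * Real.exp (A + B) ≤ 1)
    (hs : ∀ i ∈ s, ε ≤ |(a i).im|) (h0 : ∀ i ∈ s, f (a i) = 0) :
    ∑ i ∈ s, |(a i).im| / ‖(x : ℂ) - a i‖ ^ 2 ≤ 4 / ε * (A + B * ε + Real.log 2) := by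
  rw [← Finset.sum_filter_add_sum_filter_not s fun i => 0 ≤ (a i).im]
  have hupper : ∑ i ∈ s with 0 ≤ (a i).im, |(a i).im| / ‖(x : ℂ) - a i‖ ^ 2 ≤
      2 / ε * (A + B * ε + Real.log 2) := by
    have hmem : ∀ i ∈ s.filter fun i => 0 ≤ (a i).im, i ∈ s ∧ |(a i).im| = (a i).im :=
      fun i hi => ⟨(Finset.mem_filter.1 hi).1, abs_of_nonneg (Finset.mem_filter.1 hi).2⟩
    rw [Finset.sum_congr rfl fun i hi => by rw [(hmem i hi).2]]
    exact hf.sum_im_div_le hB (ha.mono (Finset.filter_subset _ s)) hfx hε hεAB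
      (fun i hi => (hmem i hi).2 ▸ hs i (hmem i hi).1) fun i hi => h0 i (hmem i hi).1
  have hlower : ∑ i ∈ s with ¬ 0 ≤ (a i).im, |(a i).im| / ‖(x : ℂ) - a i‖ ^ 2 ≤
      2 / ε * (A + B * ε + Real.log 2) := by
    have hmem : ∀ i ∈ s.filter fun i => ¬ 0 ≤ (a i).im, i ∈ s ∧ |(a i).im| = (-a i).im :=
      fun i hi => ⟨(Finset.mem_filter.1 hi).1, abs_of_neg (not_le.1 (Finset.mem_filter.1 hi).2)⟩
    have hnorm : ∀ i, ‖(x : ℂ) - a i‖ = ‖((-x : ℝ) : ℂ) - -a i‖ := fun i => by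
      rw [← norm_neg]; push_cast; congr 1; ring
    rw [Finset.sum_congr rfl fun i hi => by rw [(hmem i hi).2, hnorm]]
    exact hf.comp_neg.sum_im_div_le hB
      (fun i hi j hj hij => ha (hmem i hi).1 (hmem j hj).1 (neg_injective hij)) (by simpa using hfx)
      hε hεAB (fun i hi => (hmem i hi).2 ▸ hs i (hmem i hi).1)
      fun i hi => by simpa using h0 i (hmem i hi).1
  calc _ ≤ _ := add_le_add hupper hlower
    _ = _ := by ring

end HasBernsteinBound

/-- A function `g` with values `δ / (x - l)` on `Λ` yields the function
`csinc (z - x) + sin (z - x) * g z / δ`, which vanishes on `Λ`. -/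
theorem IsInterpolating.exists_eq_one_and_eq_zero {Λ : Set ℂ} {δ : ℝ} (hδ : 0 < δ)
    (hsep : ∀ l ∈ Λ, δ ≤ |l.im|) (h : IsInterpolating Λ) :
    ∃ A B : ℝ, 0 ≤ B ∧ ∀ x : ℝ, ∃ f, HasBernsteinBound A B f ∧ f x = 1 ∧ ∀ l ∈ Λ, f l = 0 := by
  obtain ⟨A, B, hB, hAB⟩ := h.exists_uniform_bound
  refine ⟨Real.log (1 + Real.exp A / δ), B + 1, by positivity, fun x => ?_⟩
  have hdist : ∀ l ∈ Λ, δ ≤ ‖(x : ℂ) - l‖ := fun l hl => by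
    simpa using (hsep l hl).trans ((abs_neg l.im).symm.le.trans
      (by simpa using abs_im_le_norm ((x : ℂ) - l)))
  obtain ⟨g, hg, hgv⟩ := hAB (fun l => δ / ((x : ℂ) - l)) fun l => by
    rw [norm_div, norm_real, Real.norm_of_nonneg hδ.le]
    exact div_le_one_of_le₀ (hdist l l.2) (norm_nonneg _)
  have hd := hg.1
  have hdc := differentiable_csinc
  refine ⟨fun z => csinc (z - x) + Complex.sin (z - x) * (g z / δ),
    HasBernsteinBound.of_norm_le (by positivity) (by fun_prop) fun z => ?_, by simp [csinc_zero],
    fun l hl => ?_⟩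
  · have hcsinc := norm_csinc_le (z - x)
    have hsin := norm_sin_le (z - x)
    rw [sub_im, ofReal_im, sub_zero] at hcsinc hsin
    have hgz := hg.2 z
    calc ‖csinc (z - x) + Complex.sin (z - x) * (g z / δ)‖
        ≤ ‖csinc (z - x)‖ + ‖Complex.sin (z - x)‖ * (‖g z‖ / δ) := by
          refine (norm_add_le _ _).trans_eq ?_
          rw [norm_mul, norm_div, norm_real, Real.norm_of_nonneg hδ.le]
      _ ≤ 1 * Real.exp |z.im| + Real.exp |z.im| * (Real.exp (A + B * |z.im|) / δ) := by
          rw [one_mul]; gcongr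
      _ ≤ Real.exp (B * |z.im|) * Real.exp |z.im| +
          Real.exp |z.im| * (Real.exp (A + B * |z.im|) / δ) := by
          gcongr
          exact Real.one_le_exp (by positivity)
      _ = (1 + Real.exp A / δ) * Real.exp ((B + 1) * |z.im|) := by
          rw [Real.exp_add, add_mul B 1, one_mul, Real.exp_add]; ring
  · have hxl : (x : ℂ) - l ≠ 0 := norm_pos_iff.1 (hδ.trans_le (hdist l hl))
    have hgl : g l = δ / ((x : ℂ) - l) := hgv ⟨l, hl⟩
    have hδ' : (δ : ℂ) ≠ 0 := ofReal_ne_zero.2 hδ.ne'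
    simp only [hgl, sin_eq_mul_csinc]
    field_simp
    ring

theorem IsInterpolating.carlesonCondition {Λ : Set ℂ} {δ : ℝ} (hδ : 0 < δ)
    (hsep : ∀ l ∈ Λ, δ ≤ |l.im|) (h : IsInterpolating Λ) : CarlesonCondition Λ := by
  obtain ⟨A, B, hB, hAB⟩ := h.exists_eq_one_and_eq_zero hδ hsep
  set ε := min δ (1 / (4 * Real.exp (A + B)))
  have hε : 0 < ε := by positivity
  have hεAB : 4 * ε * Real.exp (A + B) ≤ 1 := by
    have := (le_div_iff₀ (by positivity)).1 (min_le_right δ (1 / (4 * Real.exp (A + B))))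
    linarith
  refine lt_of_le_of_lt (iSup_le fun x => ?_)
    (ENNReal.ofReal_lt_top (r := 4 / ε * (A + B * ε + Real.log 2)))
  obtain ⟨f, hf, hfx, hfl⟩ := hAB x
  rw [ENNReal.tsum_eq_iSup_sum]
  refine iSup_le fun s => ?_
  rw [← ENNReal.ofReal_sum_of_nonneg fun l _ => by positivity]
  exact ENNReal.ofReal_le_ofReal (hf.sum_abs_im_div_le hB Subtype.val_injective.injOn hfx hε hεAB
    (fun l _ => (min_le_left _ _).trans (hsep l l.2)) fun l _ => hfl l l.2)

/-! ### Discretisation of the Poisson balayage -/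

theorem card_filter_lt_add_eq {F : ℤ → ℕ} (hF : Antitone F) (hstep : ∀ k, F k ≤ F (k + 1) + 1)
    {a b : ℤ} (hab : a ≤ b) :
    ((Finset.Ico a b).filter fun k => F (k + 1) < F k).card + F b = F a := by
  induction b, hab using Int.leInduction with
  | base => simp
  | succ b hab ih =>
    have hsucc := hF (Int.le_add_one le_rfl : b ≤ b + 1)
    have hstep_b := hstep b
    rw [← Finset.insert_Ico_right_eq_Ico_add_one hab, Finset.filter_insert]
    split_ifs with hlt
    · rw [Finset.card_insert_of_notMem (by simp)]
      lia
    · lia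

theorem exists_finset_card_filter_le_eq {F : ℤ → ℕ} (hF : Antitone F)
    (hstep : ∀ k, F k ≤ F (k + 1) + 1) (hbdd : BddAbove (Set.range F)) (hzero : ∃ b, F b = 0) :
    ∃ J : Finset ℤ, ∀ c, (J.filter (c ≤ ·)).card = F c := by
  obtain ⟨a, ha⟩ := Nat.sSup_mem (Set.range_nonempty F) hbdd
  obtain ⟨b, hb⟩ := hzero
  have hmax : ∀ c, F c ≤ F a := fun c => ha ▸ le_csSup hbdd ⟨c, rfl⟩
  refine ⟨(Finset.Ico a (max a b)).filter fun k => F (k + 1) < F k, fun c => ?_⟩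
  have hFc : F (max a c) = F c := by
    rcases le_total a c with h | h
    · rw [max_eq_right h]
    · rw [max_eq_left h]
      exact (hF h).antisymm (hmax c)
  have hFb : ∀ d, b ≤ d → F d = 0 := fun d hd => Nat.le_zero.1 (hb ▸ hF hd)
  have hfilter : ((Finset.Ico a (max a b)).filter fun k => F (k + 1) < F k).filter (c ≤ ·) =
      (Finset.Ico (max a c) (max (max a c) b)).filter fun k => F (k + 1) < F k := by
    ext k
    simp only [Finset.mem_filter, Finset.mem_Ico, max_le_iff, lt_max_iff]
    lia
  have hcard := card_filter_lt_add_eq hF hstep (le_max_left (max a c) b)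
  rw [hFb _ (le_max_right _ _), add_zero, hFc] at hcard
  rw [hfilter, hcard]

theorem exists_finset_card_filter_lt_mul {U : ℝ → ℝ} {h n : ℝ} (hh : 0 < h) (hU : Antitone U)
    (hstep : ∀ x, U x ≤ U (x + h) + 1) (hbot : Tendsto U atBot (𝓝 n))
    (htop : Tendsto U atTop (𝓝 0)) :
    ∃ J : Finset ℤ, ∀ x, ((J.filter fun k : ℤ => x < k * h).card : ℝ) ≤ U x ∧
      U x ≤ (J.filter fun k : ℤ => x < k * h).card + 2 := by
  have hU0 : ∀ x, 0 ≤ U x := hU.le_of_tendsto htop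
  have hgrid : Tendsto (fun k : ℤ => k * h) atTop atTop :=
    tendsto_intCast_atTop_atTop.atTop_mul_const hh
  obtain ⟨J, hJ⟩ := exists_finset_card_filter_le_eq (F := fun k => ⌊U (k * h)⌋₊)
    (fun k l hkl => Nat.floor_mono (hU (by gcongr)))
    (fun k => by
      rw [← Nat.floor_add_one (hU0 _)]
      refine Nat.floor_mono ((hstep _).trans_eq ?_)
      push_cast
      rw [add_one_mul])
    ⟨⌊n⌋₊, by rintro _ ⟨k, rfl⟩; exact Nat.floor_mono (hU.ge_of_tendsto hbot _)⟩
    (((htop.comp hgrid).eventually_lt_const one_pos).exists.imp fun k hk =>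
      Nat.floor_eq_zero.2 hk)
  refine ⟨J, fun x => ?_⟩
  set c : ℤ := ⌊x / h⌋ + 1 with hc
  have hlt : x < c * h := by
    rw [← div_lt_iff₀ hh, hc]; push_cast; exact Int.lt_floor_add_one _
  have hle : c * h ≤ x + h := by
    have := (le_div_iff₀ hh).1 (Int.floor_le (x / h))
    rw [hc]; push_cast; linarith
  have hcard : (J.filter fun k : ℤ => x < k * h).card = ⌊U (c * h)⌋₊ := by
    rw [← hJ c]
    congr 1
    refine Finset.filter_congr fun k _ => ?_
    rw [← div_lt_iff₀ hh, ← Int.floor_lt, hc, Int.add_one_le_iff]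
  rw [hcard]
  refine ⟨(Nat.floor_le (hU0 _)).trans (hU hlt.le), ?_⟩
  linarith [hstep x, hU hle, Nat.lt_floor_add_one (U (c * h))]

theorem exists_finset_abs_sub_sum_sign_le {S : ℝ → ℝ} {h : ℝ} {n : ℕ} (hh : 0 < h)
    (hS : Antitone S) (hstep : ∀ x, S x ≤ S (x + h) + Real.pi)
    (hbot : Tendsto S atBot (𝓝 (n * (Real.pi / 2))))
    (htop : Tendsto S atTop (𝓝 (n * -(Real.pi / 2)))) :
    ∃ J : Finset ℤ, ∀ x,
      |S x - ∑ k ∈ J, (if x < k * h then Real.pi / 2 else -(Real.pi / 2))| ≤ 2 * Real.pi := by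
  have hpi := Real.pi_pos
  set U : ℝ → ℝ := fun x => S x / Real.pi + n / 2 with hUdef
  have hUbot : Tendsto U atBot (𝓝 n) := by
    convert (hbot.div_const Real.pi).add_const (n / 2 : ℝ) using 2
    field_simp; ring
  have hUtop : Tendsto U atTop (𝓝 0) := by
    convert (htop.div_const Real.pi).add_const (n / 2 : ℝ) using 2
    field_simp; ring
  obtain ⟨J, hJ⟩ := exists_finset_card_filter_lt_mul hh
    (fun x y hxy => by simp only [hUdef]; gcongr; exact hS hxy)
    (fun x => by
      have := div_le_div_of_nonneg_right (hstep x) hpi.le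
      rw [add_div, div_self hpi.ne'] at this
      simp only [hUdef]; linarith) hUbot hUtop
  have hfull : ∀ᶠ x : ℝ in atBot, J.filter (fun k : ℤ => x < k * h) = J := by
    have : ∀ᶠ x : ℝ in atBot, ∀ k ∈ J, x < k * h :=
      (Finset.eventually_all _).2 fun k _ => eventually_lt_atBot _
    filter_upwards [this] with x hx using Finset.filter_true_of_mem hx
  have hcard_le : (J.card : ℝ) ≤ n :=
    ge_of_tendsto hUbot (hfull.mono fun x hx => by simpa only [hx] using (hJ x).1)
  have hle_card : (n : ℝ) ≤ J.card + 2 :=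
    le_of_tendsto hUbot (hfull.mono fun x hx => by simpa only [hx] using (hJ x).2)
  refine ⟨J, fun x => ?_⟩
  have hsum : ∑ k ∈ J, (if x < k * h then Real.pi / 2 else -(Real.pi / 2)) =
      Real.pi * (J.filter fun k : ℤ => x < k * h).card - J.card * (Real.pi / 2) := by
    have : ∀ k ∈ J, (if x < k * h then Real.pi / 2 else -(Real.pi / 2)) =
        Real.pi * (if x < k * h then 1 else 0) - Real.pi / 2 := fun k _ => by
      split_ifs <;> ring
    rw [Finset.sum_congr rfl this, Finset.sum_sub_distrib, ← Finset.mul_sum, Finset.sum_boole,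
      Finset.sum_const, nsmul_eq_mul]
  have hSU : S x = Real.pi * U x - n * (Real.pi / 2) := by
    simp only [hUdef]; field_simp; ring
  obtain ⟨hlow, hup⟩ := hJ x
  rw [hsum, hSU, abs_le]
  constructor <;> nlinarith

/-- The sum `∑ |Im w| / |x - w|²` over `s`: up to the factor `π`, the density at `x` of the
sum of the harmonic measures of the points of `s` in their half-planes. -/
noncomputable def balayage (s : Finset ℂ) (x : ℝ) : ℝ :=
  ∑ w ∈ s, |w.im| / ‖(x : ℂ) - w‖ ^ 2

/-- A decreasing primitive of `-balayage s`. -/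
noncomputable def angleSum (s : Finset ℂ) (x : ℝ) : ℝ :=
  ∑ w ∈ s, Real.arctan ((w.re - x) / |w.im|)

section Balayage

variable {s : Finset ℂ}

theorem balayage_nonneg (s : Finset ℂ) (x : ℝ) : 0 ≤ balayage s x :=
  Finset.sum_nonneg fun _ _ => by positivity

theorem balayage_mono {t : Finset ℂ} (hst : s ⊆ t) (x : ℝ) : balayage s x ≤ balayage t x :=
  Finset.sum_le_sum_of_subset_of_nonneg hst fun _ _ _ => by positivity

theorem norm_ofReal_sub_sq (x : ℝ) (w : ℂ) : ‖(x : ℂ) - w‖ ^ 2 = (x - w.re) ^ 2 + w.im ^ 2 := by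
  rw [Complex.sq_norm, normSq_apply]
  simp only [sub_re, ofReal_re, sub_im, ofReal_im]
  ring

theorem hasDerivAt_angleSum (hs : ∀ w ∈ s, w.im ≠ 0) (x : ℝ) :
    HasDerivAt (angleSum s) (-balayage s x) x := by
  rw [balayage, ← Finset.sum_neg_distrib]
  refine HasDerivAt.fun_sum fun w hw => ?_
  have hb : 0 < |w.im| := abs_pos.2 (hs w hw)
  have hlin : HasDerivAt (fun x : ℝ => (w.re - x) / |w.im|) (-1 / |w.im|) x :=
    ((hasDerivAt_id x).const_sub w.re).div_const |w.im|
  refine hlin.arctan.congr_deriv ?_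
  rw [norm_ofReal_sub_sq, ← sq_abs w.im]
  have : (x - w.re) ^ 2 + |w.im| ^ 2 ≠ 0 := by positivity
  field_simp
  ring

theorem antitone_angleSum (hs : ∀ w ∈ s, w.im ≠ 0) : Antitone (angleSum s) :=
  antitone_of_hasDerivAt_nonpos (hasDerivAt_angleSum hs)
    fun x => neg_nonpos.2 (balayage_nonneg s x)

theorem angleSum_le_add_mul (hs : ∀ w ∈ s, w.im ≠ 0) {M : ℝ} (hM : ∀ x, balayage s x ≤ M)
    {h : ℝ} (hh : 0 ≤ h) (x : ℝ) : angleSum s x ≤ angleSum s (x + h) + M * h := by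
  have hmono : Monotone fun x => angleSum s x + M * x :=
    monotone_of_hasDerivAt_nonneg (f' := fun x => -balayage s x + M)
      (fun x => (hasDerivAt_angleSum hs x).add (by simpa using (hasDerivAt_id x).const_mul M))
      fun x => by simpa using hM x
  have := hmono (le_add_of_nonneg_right hh : x ≤ x + h)
  simp only at this
  linarith

theorem tendsto_angleSum_atBot (hs : ∀ w ∈ s, w.im ≠ 0) :
    Tendsto (angleSum s) atBot (𝓝 (s.card * (Real.pi / 2))) := by
  rw [← nsmul_eq_mul, ← Finset.sum_const]
  refine tendsto_finsetSum _ fun w hw =>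
    (tendsto_nhds_of_tendsto_nhdsWithin Real.tendsto_arctan_atTop).comp ?_
  exact (tendsto_atTop_add_const_left _ _ tendsto_neg_atBot_atTop).atTop_div_const
    (abs_pos.2 (hs w hw))

theorem tendsto_angleSum_atTop (hs : ∀ w ∈ s, w.im ≠ 0) :
    Tendsto (angleSum s) atTop (𝓝 (s.card * -(Real.pi / 2))) := by
  rw [← nsmul_eq_mul, ← Finset.sum_const]
  refine tendsto_finsetSum _ fun w hw =>
    (tendsto_nhds_of_tendsto_nhdsWithin Real.tendsto_arctan_atBot).comp ?_
  exact (tendsto_atBot_add_const_left _ _ tendsto_neg_atTop_atBot).atBot_div_const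
    (abs_pos.2 (hs w hw))

theorem exists_finset_abs_angleSum_sub_le (hs : ∀ w ∈ s, w.im ≠ 0) {M : ℝ} (hM0 : 0 < M)
    (hM : ∀ x, balayage s x ≤ M) :
    ∃ J : Finset ℤ, ∀ x, |angleSum s x - ∑ k ∈ J,
      (if x < k * (Real.pi / M) then Real.pi / 2 else -(Real.pi / 2))| ≤ 2 * Real.pi := by
  have hh : 0 < Real.pi / M := by positivity
  refine exists_finset_abs_sub_sum_sign_le hh (antitone_angleSum hs) (fun x => ?_)
    (tendsto_angleSum_atBot hs) (tendsto_angleSum_atTop hs)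
  simpa [mul_div_cancel₀ _ hM0.ne'] using angleSum_le_add_mul hs hM hh.le x

end Balayage

/-! ### Quotients of linear factors with bounded argument -/

section LogQuotient

variable {ι κ : Type*} (S : Finset ι) (p : ι → ℂ) (J : Finset κ) (γ : κ → ℝ)

/-- A logarithm of `∏ (ζ + p i) / ∏ (ζ + i γ j)`, holomorphic in the right half-plane when the
points `p i` lie there. -/
noncomputable def logQuotient (ζ : ℂ) : ℂ :=
  ∑ i ∈ S, Complex.log (ζ + p i) - ∑ j ∈ J, Complex.log (ζ + γ j * I)

/-- The factor `w ^ (iσ)`, regularised by `(w / (w + 1)) ^ η` so as to vanish continuously at the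
boundary point `0` of the right half-plane. -/
noncomputable def atomFactor (σ η : ℝ) (w : ℂ) : ℂ :=
  w ^ (σ * I + η : ℂ) * Complex.exp (-η * Complex.log (w + 1))

/-- The function `exp (-iσ * logQuotient)`, with regularised factors at the points `-i γ j`. -/
noncomputable def regularisedQuotient (σ η : ℝ) (ζ : ℂ) : ℂ :=
  Complex.exp (-σ * I * ∑ i ∈ S, Complex.log (ζ + p i)) * ∏ j ∈ J, atomFactor σ η (ζ + γ j * I)

variable {S p J γ}

theorem logQuotient_im (ζ : ℂ) :
    (logQuotient S p J γ ζ).im = ∑ i ∈ S, arg (ζ + p i) - ∑ j ∈ J, arg (ζ + γ j * I) := by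
  simp only [logQuotient, sub_im, im_sum, log_im]

theorem add_mem_slitPlane {ζ w : ℂ} (hζ : 0 ≤ ζ.re) (hw : 0 < w.re) : ζ + w ∈ slitPlane :=
  Or.inl (by rw [add_re]; linarith)

theorem add_ofReal_mul_I_mem_slitPlane {ζ : ℂ} (hζ : 0 < ζ.re) (t : ℝ) :
    ζ + t * I ∈ slitPlane :=
  Or.inl (by simpa using hζ)

theorem differentiableOn_logQuotient (hp : ∀ i ∈ S, 0 < (p i).re) :
    DifferentiableOn ℂ (logQuotient S p J γ) {ζ | 0 < ζ.re} := by
  intro ζ (hζ : 0 < ζ.re)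
  refine (DifferentiableAt.fun_sub (DifferentiableAt.fun_sum fun i hi => ?_)
    (DifferentiableAt.fun_sum fun j _ => ?_)).differentiableWithinAt
  · exact DifferentiableAt.clog (by fun_prop) (add_mem_slitPlane hζ.le (hp i hi))
  · exact DifferentiableAt.clog (by fun_prop) (add_ofReal_mul_I_mem_slitPlane hζ (γ j))

theorem norm_exp_logQuotient (hp : ∀ i ∈ S, 0 < (p i).re) {ζ : ℂ} (hζ : 0 < ζ.re) :
    ‖Complex.exp (logQuotient S p J γ ζ)‖ =
      (∏ i ∈ S, ‖ζ + p i‖) / ∏ j ∈ J, ‖ζ + γ j * I‖ := by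
  rw [logQuotient, Complex.exp_sub, Complex.exp_sum, Complex.exp_sum, norm_div, norm_prod,
    norm_prod]
  congr 1
  · refine Finset.prod_congr rfl fun i hi => ?_
    rw [exp_log (slitPlane_ne_zero (add_mem_slitPlane hζ.le (hp i hi)))]
  · refine Finset.prod_congr rfl fun j _ => ?_
    rw [exp_log (slitPlane_ne_zero (add_ofReal_mul_I_mem_slitPlane hζ (γ j)))]

theorem abs_sum_arg_le (f : ι → ℂ) : |∑ i ∈ S, arg (f i)| ≤ S.card * Real.pi := by
  rw [← nsmul_eq_mul]
  exact (Finset.abs_sum_le_sum_abs _ _).trans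
    (Finset.sum_le_card_nsmul _ _ _ fun i _ => abs_arg_le_pi _)

theorem abs_logQuotient_im_le (ζ : ℂ) :
    |(logQuotient S p J γ ζ).im| ≤ S.card * Real.pi + J.card * Real.pi := by
  rw [logQuotient_im]
  exact (abs_sub _ _).trans (add_le_add (abs_sum_arg_le _) (abs_sum_arg_le _))

theorem atomFactor_zero (σ : ℝ) {η : ℝ} (hη : η ≠ 0) : atomFactor σ η 0 = 0 := by
  have : (σ * I + η : ℂ) ≠ 0 := fun h => hη (by simpa using congrArg re h)
  rw [atomFactor, zero_cpow this, zero_mul]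

theorem norm_atomFactor (σ η : ℝ) {w : ℂ} (hw : w ≠ 0) (hre : 0 ≤ w.re) :
    ‖atomFactor σ η w‖ = (‖w‖ / ‖w + 1‖) ^ η * Real.exp (-(σ * arg w)) := by
  have hw1 : w + 1 ≠ 0 := slitPlane_ne_zero (add_mem_slitPlane hre (by simp))
  rw [atomFactor, norm_mul, norm_cpow_of_ne_zero hw, Complex.norm_exp,
    Real.div_rpow (norm_nonneg _) (norm_nonneg _), Real.rpow_def_of_pos (norm_pos_iff.2 hw1)]
  simp only [add_re, mul_re, ofReal_re, I_re, mul_zero, ofReal_im, I_im, mul_one, sub_self,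
    zero_add, add_im, mul_im, add_zero, neg_re, zero_mul, sub_zero, log_re, neg_mul, Real.exp_neg]
  rw [mul_comm σ, mul_comm η]
  field_simp

theorem norm_div_norm_add_one_le_one {w : ℂ} (hre : 0 ≤ w.re) : ‖w‖ / ‖w + 1‖ ≤ 1 := by
  refine div_le_one_of_le₀ (le_of_sq_le_sq ?_ (norm_nonneg _)) (norm_nonneg _)
  simp only [Complex.sq_norm, normSq_apply, add_re, one_re, add_im, one_im]
  nlinarith

theorem differentiableAt_atomFactor (σ η : ℝ) {w : ℂ} (hw : 0 < w.re) :
    DifferentiableAt ℂ (atomFactor σ η) w := by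
  refine DifferentiableAt.mul (differentiableAt_id.cpow_const (Or.inl hw))
    (DifferentiableAt.cexp (DifferentiableAt.const_mul ?_ _))
  exact DifferentiableAt.clog (by fun_prop) (add_mem_slitPlane hw.le (by simp))

theorem continuousAt_atomFactor (σ : ℝ) {η : ℝ} (hη : 0 < η) {w : ℂ} (hw : 0 ≤ w.re) :
    ContinuousAt (atomFactor σ η) w := by
  have hexpo : 0 < (σ * I + η : ℂ).re := by simpa using hη
  refine ContinuousAt.mul (continuousAt_cpow_const_of_re_pos (Or.inl hw) hexpo)
    (ContinuousAt.cexp (ContinuousAt.mul continuousAt_const ?_))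
  exact ContinuousAt.clog (by fun_prop) (add_mem_slitPlane hw (by simp))

theorem norm_regularisedQuotient (σ η : ℝ) {ζ : ℂ} (hζ : 0 ≤ ζ.re)
    (hJ : ∀ j ∈ J, ζ + γ j * I ≠ 0) :
    ‖regularisedQuotient S p J γ σ η ζ‖ =
      (∏ j ∈ J, (‖ζ + γ j * I‖ / ‖ζ + γ j * I + 1‖) ^ η) *
        Real.exp (σ * (logQuotient S p J γ ζ).im) := by
  have hexp : ‖Complex.exp (-σ * I * ∑ i ∈ S, Complex.log (ζ + p i))‖ =
      Real.exp (σ * ∑ i ∈ S, arg (ζ + p i)) := by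
    rw [Complex.norm_exp]
    simp [log_im]
  rw [regularisedQuotient, norm_mul, norm_prod, hexp,
    Finset.prod_congr rfl fun j hj => norm_atomFactor σ η (hJ j hj) (by simpa using hζ),
    Finset.prod_mul_distrib, ← Real.exp_sum, Finset.sum_neg_distrib, ← Finset.mul_sum,
    mul_left_comm, ← Real.exp_add, logQuotient_im, mul_sub, sub_eq_add_neg]

theorem norm_regularisedQuotient_le (σ : ℝ) {η : ℝ} (hη : 0 ≤ η) {ζ : ℂ} (hζ : 0 ≤ ζ.re)
    (hJ : ∀ j ∈ J, ζ + γ j * I ≠ 0) :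
    ‖regularisedQuotient S p J γ σ η ζ‖ ≤ Real.exp (σ * (logQuotient S p J γ ζ).im) := by
  rw [norm_regularisedQuotient σ η hζ hJ]
  exact mul_le_of_le_one_left (Real.exp_pos _).le (Finset.prod_le_one (fun j _ => by positivity)
    fun j _ => Real.rpow_le_one (by positivity)
      (norm_div_norm_add_one_le_one (by simpa using hζ)) hη)

theorem diffContOnCl_regularisedQuotient (hp : ∀ i ∈ S, 0 < (p i).re) (σ : ℝ) {η : ℝ}
    (hη : 0 < η) : DiffContOnCl ℂ (regularisedQuotient S p J γ σ η) {ζ | 0 < ζ.re} := by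
  constructor
  · intro ζ (hζ : 0 < ζ.re)
    refine (DifferentiableAt.mul (DifferentiableAt.cexp (DifferentiableAt.const_mul ?_ _))
      (DifferentiableAt.fun_finsetProd fun j _ => ?_)).differentiableWithinAt
    · exact DifferentiableAt.fun_sum fun i hi =>
        DifferentiableAt.clog (by fun_prop) (add_mem_slitPlane hζ.le (hp i hi))
    · exact (differentiableAt_atomFactor σ η (by simpa using hζ)).comp ζ (by fun_prop)
  · rw [closure_setOfPred_lt_re]
    intro ζ (hζ : 0 ≤ ζ.re)
    refine (ContinuousAt.mul (ContinuousAt.cexp (ContinuousAt.mul continuousAt_const ?_))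
      (tendsto_finsetProd _ fun j _ => ?_)).continuousWithinAt
    · exact tendsto_finsetSum _ fun i hi =>
        ContinuousAt.clog (by fun_prop) (add_mem_slitPlane hζ (hp i hi))
    · exact ContinuousAt.comp (f := fun ζ : ℂ => ζ + γ j * I)
        (continuousAt_atomFactor σ hη (by simpa using hζ)) (by fun_prop)

theorem norm_regularisedQuotient_le_of_boundary (hp : ∀ i ∈ S, 0 < (p i).re) {σ c : ℝ}
    (h : ∀ x : ℝ, (∀ j ∈ J, γ j ≠ -x) → σ * (logQuotient S p J γ (x * I)).im ≤ c)
    {η : ℝ} (hη : 0 < η) {ζ : ℂ} (hζ : 0 ≤ ζ.re) :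
    ‖regularisedQuotient S p J γ σ η ζ‖ ≤ Real.exp c := by
  refine norm_le_of_imaginary_axis (diffContOnCl_regularisedQuotient hp σ hη)
    (Asymptotics.IsBigO.of_bound (Real.exp (|σ| * (S.card * Real.pi + J.card * Real.pi))) ?_)
    (fun x => ?_) hζ
  · filter_upwards [mem_inf_of_right (mem_principal_self _)] with ζ hζ
    rw [norm_one, mul_one]
    refine (norm_regularisedQuotient_le σ hη.le (le_of_lt hζ) fun j _ =>
      slitPlane_ne_zero (add_ofReal_mul_I_mem_slitPlane hζ (γ j))).trans (Real.exp_le_exp.2 ?_)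
    refine (le_abs_self _).trans ?_
    rw [abs_mul]
    gcongr
    exact abs_logQuotient_im_le ζ
  · have hatom : ∀ j, (x : ℂ) * I + γ j * I = ((x + γ j : ℝ) : ℂ) * I := fun j => by
      push_cast; ring
    by_cases hx : ∃ j ∈ J, γ j = -x
    · obtain ⟨j, hj, hjx⟩ := hx
      have hzero : regularisedQuotient S p J γ σ η (x * I) = 0 := by
        refine mul_eq_zero_of_right _ (Finset.prod_eq_zero hj ?_)
        rw [hatom, hjx, add_neg_cancel, ofReal_zero, zero_mul, atomFactor_zero σ hη.ne']
      rw [hzero, norm_zero]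
      positivity
    · push Not at hx
      refine (norm_regularisedQuotient_le σ hη.le (by simp) fun j hj => ?_).trans
        (Real.exp_le_exp.2 (h x hx))
      rw [hatom, mul_ne_zero_iff_right I_ne_zero, ofReal_ne_zero]
      exact fun h0 => hx j hj (by linarith)

theorem mul_logQuotient_im_le_of_boundary (hp : ∀ i ∈ S, 0 < (p i).re) {σ c : ℝ}
    (h : ∀ x : ℝ, (∀ j ∈ J, γ j ≠ -x) → σ * (logQuotient S p J γ (x * I)).im ≤ c)
    {ζ : ℂ} (hζ : 0 < ζ.re) : σ * (logQuotient S p J γ ζ).im ≤ c := by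
  have hJ : ∀ j ∈ J, ζ + γ j * I ≠ 0 := fun j _ =>
    slitPlane_ne_zero (add_ofReal_mul_I_mem_slitPlane hζ (γ j))
  have hlim : Tendsto (fun η : ℝ => (∏ j ∈ J, (‖ζ + γ j * I‖ / ‖ζ + γ j * I + 1‖) ^ η) *
      Real.exp (σ * (logQuotient S p J γ ζ).im)) (𝓝[>] 0)
      (𝓝 ((∏ j ∈ J, (‖ζ + γ j * I‖ / ‖ζ + γ j * I + 1‖) ^ (0 : ℝ)) *
        Real.exp (σ * (logQuotient S p J γ ζ).im))) := by
    refine (Tendsto.mul_const _ (tendsto_finsetProd _ fun j hj => ?_)).mono_left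
      nhdsWithin_le_nhds
    have hne : ζ + γ j * I + 1 ≠ 0 :=
      slitPlane_ne_zero (add_mem_slitPlane (by simpa using hζ.le) (by simp))
    exact Real.continuousAt_const_rpow
      (div_ne_zero (norm_ne_zero_iff.2 (hJ j hj)) (norm_ne_zero_iff.2 hne))
  have hle := le_of_tendsto hlim (b := Real.exp c) (by
    filter_upwards [self_mem_nhdsWithin] with η hη
    rw [← norm_regularisedQuotient σ η hζ.le hJ]
    exact norm_regularisedQuotient_le_of_boundary hp h hη hζ.le)
  simpa using hle

theorem abs_logQuotient_im_le_of_boundary (hp : ∀ i ∈ S, 0 < (p i).re) {c : ℝ}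
    (h : ∀ x : ℝ, (∀ j ∈ J, γ j ≠ -x) → |(logQuotient S p J γ (x * I)).im| ≤ c)
    {ζ : ℂ} (hζ : 0 < ζ.re) : |(logQuotient S p J γ ζ).im| ≤ c := by
  have hup := mul_logQuotient_im_le_of_boundary (σ := 1) (c := c) hp
    (fun x hx => by linarith [(abs_le.1 (h x hx)).2]) hζ
  have hlow := mul_logQuotient_im_le_of_boundary (σ := -1) (c := c) hp
    (fun x hx => by linarith [(abs_le.1 (h x hx)).1]) hζ
  exact abs_le.2 ⟨by linarith, by linarith⟩

end LogQuotient

section SchwarzPick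

variable {u v : ℂ}

theorem norm_sub_lt_norm_add_conj (hu : 0 < u.re) (hv : 0 < v.re) : ‖u - v‖ < ‖u + conj v‖ := by
  refine lt_of_pow_lt_pow_left₀ 2 (norm_nonneg _) ?_
  simp only [Complex.sq_norm, normSq_apply, sub_re, sub_im, add_re, add_im, conj_re, conj_im]
  nlinarith [mul_pos hu hv]

theorem add_conj_ne_zero (hu : 0 < u.re) (hv : 0 < v.re) : u + conj v ≠ 0 :=
  slitPlane_ne_zero (add_mem_slitPlane hu.le (by simpa using hv))

theorem one_sub_ne_zero_of_norm_lt_one {w : ℂ} (hw : ‖w‖ < 1) : 1 - w ≠ 0 := fun h => by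
  rw [← sub_eq_zero.1 h, norm_one] at hw
  exact lt_irrefl _ hw

/-- The Cayley transform from the unit disc onto the right half-plane with `0 ↦ v`. -/
noncomputable def cayley (v w : ℂ) : ℂ := v.re * ((1 + w) / (1 - w)) + v.im * I

theorem cayley_zero (v : ℂ) : cayley v 0 = v := by simp [cayley, re_add_im]

theorem cayley_re_pos (hv : 0 < v.re) {w : ℂ} (hw : ‖w‖ < 1) : 0 < (cayley v w).re := by
  have hden := normSq_pos.2 (one_sub_ne_zero_of_norm_lt_one hw)
  have hre : (cayley v w).re = v.re * ((1 - normSq w) / normSq (1 - w)) := by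
    simp only [cayley, add_re, mul_re, ofReal_re, ofReal_im, zero_mul, sub_zero, I_re, mul_zero,
      I_im, div_re, normSq_apply, sub_im, sub_re, one_re, one_im, add_im]
    ring
  have hnum : 0 < 1 - normSq w := by
    rw [normSq_eq_norm_sq, sub_pos]
    exact pow_lt_one₀ (norm_nonneg w) hw two_ne_zero
  rw [hre]
  positivity

theorem differentiableOn_cayley (v : ℂ) : DifferentiableOn ℂ (cayley v) (Metric.ball 0 1) :=
  fun w hw => by
    have := one_sub_ne_zero_of_norm_lt_one (mem_ball_zero_iff.1 hw)
    refine DifferentiableAt.differentiableWithinAt ?_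
    unfold cayley
    fun_prop (disch := assumption)

theorem cayley_sub_div_add_conj (hu : 0 < u.re) (hv : 0 < v.re) :
    cayley v ((u - v) / (u + conj v)) = u := by
  have hne := add_conj_ne_zero hu hv
  have hre : (v.re : ℂ) ≠ 0 := ofReal_ne_zero.2 hv.ne'
  have hv_eq : v = v.re + v.im * I := (re_add_im v).symm
  have hconj : conj v = v.re - v.im * I := by apply Complex.ext <;> simp
  have hden : 1 - (u - v) / (u + conj v) = 2 * v.re / (u + conj v) := by
    rw [eq_div_iff hne, sub_mul, div_mul_cancel₀ _ hne, hconj]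
    linear_combination hv_eq
  rw [cayley, hden]
  rw [hconj] at hne ⊢
  field_simp
  linear_combination -hv_eq

variable {L : ℂ → ℂ}

theorem norm_sub_div_norm_add_conj_le (hL : DifferentiableOn ℂ L {z | 0 < z.re})
    (hre : ∀ z : ℂ, 0 < z.re → 0 < (L z).re) (hu : 0 < u.re) (hv : 0 < v.re) :
    ‖L u - L v‖ / ‖L u + conj (L v)‖ ≤ ‖u - v‖ / ‖u + conj v‖ := by
  have hpos : ∀ w ∈ Metric.ball (0 : ℂ) 1, 0 < (cayley v w).re := fun w hw =>
    cayley_re_pos hv (mem_ball_zero_iff.1 hw)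
  have hcomp : DifferentiableOn ℂ (fun w => L (cayley v w)) (Metric.ball 0 1) :=
    hL.comp (differentiableOn_cayley v) hpos
  have hSchwarz := norm_le_norm_of_mapsTo_ball (R := 1)
    (f := fun w => (L (cayley v w) - L v) / (L (cayley v w) + conj (L v)))
    (z := (u - v) / (u + conj v))
    ((hcomp.sub_const _).div (hcomp.add_const _) fun w hw =>
      add_conj_ne_zero (hre _ (hpos w hw)) (hre v hv))
    (fun w hw => by
      rw [mem_closedBall_zero_iff, norm_div]
      exact div_le_one_of_le₀ (norm_sub_lt_norm_add_conj (hre _ (hpos w hw)) (hre v hv)).le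
        (norm_nonneg _))
    (by simp [cayley_zero])
    (by
      rw [norm_div, div_lt_one (norm_pos_iff.2 (add_conj_ne_zero hu hv))]
      exact norm_sub_lt_norm_add_conj hu hv)
  rwa [cayley_sub_div_add_conj hu hv, norm_div, norm_div] at hSchwarz

theorem norm_mul_le_of_re_pos (hL : DifferentiableOn ℂ L {z | 0 < z.re})
    (hre : ∀ z : ℂ, 0 < z.re → 0 < (L z).re) (hu : 0 < u.re) (hv : 0 < v.re) :
    ‖L u‖ * (u.re * v.re) ≤ ‖L v‖ * ‖u + conj v‖ ^ 2 := by
  have hPick := norm_sub_div_norm_add_conj_le hL hre hu hv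
  rw [div_le_div_iff₀ (norm_pos_iff.2 (add_conj_ne_zero (hre u hu) (hre v hv)))
    (norm_pos_iff.2 (add_conj_ne_zero hu hv))] at hPick
  have hsub := norm_sub_norm_le (L u) (L v)
  have hadd := norm_add_le (L u) (conj (L v))
  rw [Complex.norm_conj] at hadd
  have hsq : ‖u - v‖ ^ 2 + 4 * (u.re * v.re) = ‖u + conj v‖ ^ 2 := by
    simp only [Complex.sq_norm, normSq_apply, sub_re, sub_im, add_re, add_im, conj_re, conj_im]
    ring
  have hlt := (norm_sub_lt_norm_add_conj hu hv).le
  have hr : 0 ≤ ‖u - v‖ := norm_nonneg _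
  set a := ‖L u‖
  set b := ‖L v‖
  set r := ‖u - v‖
  set q := ‖u + conj v‖
  have hcross : a * (q - r) ≤ b * (q + r) := by
    have : (a - b) * q ≤ r * (a + b) :=
      calc (a - b) * q ≤ ‖L u - L v‖ * q := by gcongr
        _ ≤ r * ‖L u + conj (L v)‖ := hPick
        _ ≤ r * (a + b) := by gcongr
    linarith
  have : 4 * (a * (u.re * v.re)) ≤ 4 * (b * q ^ 2) :=
    calc 4 * (a * (u.re * v.re)) = a * (q - r) * (q + r) := by linear_combination a * hsq
      _ ≤ b * (q + r) * (q + r) := by gcongr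
      _ ≤ b * (q + q) * (q + q) := by gcongr
      _ = 4 * (b * q ^ 2) := by ring
  linarith

theorem norm_exp_le_of_abs_im_le {g : ℂ → ℂ} (hg : DifferentiableOn ℂ g {z | 0 < z.re})
    (him : ∀ z : ℂ, 0 < z.re → |(g z).im| ≤ 2 * Real.pi) (hu : 0 < u.re) (hv : 0 < v.re) :
    ‖Complex.exp (g u)‖ ≤
      ‖Complex.exp (g v)‖ * (‖u + conj v‖ ^ 2 / (u.re * v.re)) ^ 8 := by
  -- `exp (g / 8)` maps the right half-plane into itself.
  have hroot : ∀ z, ‖Complex.exp (g z / 8)‖ ^ 8 = ‖Complex.exp (g z)‖ := fun z => by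
    rw [← norm_pow, ← Complex.exp_nat_mul, Nat.cast_ofNat, mul_div_cancel₀ _ (by norm_num)]
  have hPick := norm_mul_le_of_re_pos (L := fun z => Complex.exp (g z / 8))
    (hg.div_const 8).cexp (fun z hz => by
      have hz := abs_le.1 (him z hz)
      have hdiv : (g z / 8).im = (g z).im / 8 := div_ofNat_im (g z) 8
      rw [Complex.exp_re, hdiv]
      have := Real.pi_pos
      exact mul_pos (Real.exp_pos _) (Real.cos_pos_of_mem_Ioo ⟨by linarith, by linarith⟩)) hu hv
  rw [← hroot, ← hroot, ← mul_pow]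
  gcongr
  rwa [← mul_div_assoc, le_div_iff₀ (by positivity)]

end SchwarzPick

/-! ### Growth in horizontal strips -/

/-- The filter `|Re z| → ∞` in the strip `|Im z| < 1`. -/
def stripEnds : Filter ℂ := comap (abs ∘ re) atTop ⊓ 𝓟 (im ⁻¹' Set.Ioo (-1) 1)

/-- At most exponential growth at the ends of the strip `|Im z| < 1`, the a priori bound that makes
the Phragmén–Lindelöf principle available there. -/
def HasStripGrowth (f : ℂ → ℂ) : Prop :=
  ∃ N : ℕ, f =O[stripEnds] fun z => Real.exp (N * |z.re|)

theorem eventually_stripEnds_abs_im_lt : ∀ᶠ z in stripEnds, |z.im| < 1 := by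
  filter_upwards [mem_inf_of_right (mem_principal_self (im ⁻¹' Set.Ioo (-1 : ℝ) 1))] with z hz
  exact abs_lt.2 hz

theorem eventually_stripEnds_le_abs_re (c : ℝ) : ∀ᶠ z in stripEnds, c ≤ |z.re| :=
  (tendsto_comap.eventually (eventually_ge_atTop c)).filter_mono inf_le_left

namespace HasStripGrowth

variable {f g : ℂ → ℂ}

theorem of_eventually_le {C : ℝ} (h : ∀ᶠ z in stripEnds, ‖f z‖ ≤ C) : HasStripGrowth f :=
  ⟨0, Asymptotics.IsBigO.of_bound C (by simpa using h)⟩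

theorem of_eventually_norm_le (hg : HasStripGrowth g) (h : ∀ᶠ z in stripEnds, ‖f z‖ ≤ ‖g z‖) :
    HasStripGrowth f :=
  let ⟨N, hN⟩ := hg
  ⟨N, (Asymptotics.IsBigO.of_bound' h).trans hN⟩

theorem of_exp_im {A B : ℝ} (hB : 0 ≤ B) (h : ∀ z, ‖f z‖ ≤ A * Real.exp (B * |z.im|)) :
    HasStripGrowth f := by
  have hA : 0 ≤ A := by simpa using (norm_nonneg _).trans (h 0)
  refine of_eventually_le (C := A * Real.exp B) ?_
  filter_upwards [eventually_stripEnds_abs_im_lt] with z hz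
  refine (h z).trans ?_
  gcongr
  exact mul_le_of_le_one_right hB hz.le

theorem const (c : ℂ) : HasStripGrowth fun _ => c :=
  of_eventually_le (Eventually.of_forall fun _ => le_refl ‖c‖)

theorem sub_const (w : ℂ) : HasStripGrowth fun z => z - w := by
  refine ⟨1, Asymptotics.IsBigO.of_bound (2 + ‖w‖) ?_⟩
  filter_upwards [eventually_stripEnds_abs_im_lt] with z hz
  have hsub := norm_sub_le z w
  have hnorm := norm_le_abs_re_add_abs_im z
  have hexp := Real.add_one_le_exp |z.re|
  have hone := Real.one_le_exp (abs_nonneg z.re)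
  rw [Real.norm_of_nonneg (Real.exp_pos _).le, Nat.cast_one, one_mul]
  nlinarith [norm_nonneg w]

theorem mul (hf : HasStripGrowth f) (hg : HasStripGrowth g) :
    HasStripGrowth fun z => f z * g z := by
  obtain ⟨N, hN⟩ := hf
  obtain ⟨N', hN'⟩ := hg
  refine ⟨N + N', (hN.mul hN').congr_right fun z => ?_⟩
  rw [← Real.exp_add, Nat.cast_add, add_mul]

theorem add (hf : HasStripGrowth f) (hg : HasStripGrowth g) :
    HasStripGrowth fun z => f z + g z := by
  obtain ⟨N, hN⟩ := hf
  obtain ⟨N', hN'⟩ := hg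
  have hmono : ∀ {k l : ℕ}, k ≤ l → (fun z : ℂ => Real.exp (k * |z.re|))
      =O[stripEnds] fun z => Real.exp (l * |z.re|) := fun {k l} hkl => by
    refine Asymptotics.IsBigO.of_norm_le fun z => ?_
    rw [Real.norm_of_nonneg (Real.exp_pos _).le]
    gcongr
  exact ⟨max N N', (hN.trans (hmono (le_max_left _ _))).add (hN'.trans (hmono (le_max_right _ _)))⟩

theorem prod {ι : Type*} (s : Finset ι) {f : ι → ℂ → ℂ} (h : ∀ i ∈ s, HasStripGrowth (f i)) :
    HasStripGrowth fun z => ∏ i ∈ s, f i z := by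
  classical
  induction s using Finset.induction_on with
  | empty => simpa only [Finset.prod_empty] using const 1
  | insert j s hj ih =>
    simp only [Finset.prod_insert hj]
    exact (h j (Finset.mem_insert_self _ _)).mul
      (ih fun i hi => h i (Finset.mem_insert_of_mem hi))

theorem sum {ι : Type*} (s : Finset ι) {f : ι → ℂ → ℂ} (h : ∀ i ∈ s, HasStripGrowth (f i)) :
    HasStripGrowth fun z => ∑ i ∈ s, f i z := by
  classical
  induction s using Finset.induction_on with
  | empty => simpa only [Finset.sum_empty] using const 0
  | insert j s hj ih =>
    simp only [Finset.sum_insert hj]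
    exact (h j (Finset.mem_insert_self _ _)).add
      (ih fun i hi => h i (Finset.mem_insert_of_mem hi))

theorem of_mul_prod_sub {ι : Type*} {J : Finset ι} {a : ι → ℂ}
    (h : HasStripGrowth fun z => f z * ∏ j ∈ J, (z - a j)) : HasStripGrowth f := by
  refine h.of_eventually_norm_le ?_
  have hfar : ∀ᶠ z in stripEnds, ∀ j ∈ J, 1 + |(a j).re| ≤ |z.re| :=
    (Finset.eventually_all J).2 fun j _ => eventually_stripEnds_le_abs_re _
  filter_upwards [hfar] with z hz
  rw [norm_mul, norm_prod]
  have hone : ∀ j ∈ J, 1 ≤ ‖z - a j‖ := fun j hj => by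
    have hre := abs_re_le_norm (z - a j)
    rw [sub_re] at hre
    linarith [abs_sub_abs_le_abs_sub z.re (a j).re, hz j hj]
  exact le_mul_of_one_le_right (norm_nonneg _)
    (by simpa using Finset.prod_le_prod (fun _ _ => zero_le_one) hone)

theorem hasBernsteinBound (hf : HasStripGrowth f) (hd : Differentiable ℂ f) {A B : ℝ}
    (hB : 0 ≤ B) (h : ∀ z : ℂ, 1 ≤ |z.im| → ‖f z‖ ≤ Real.exp (A + B * |z.im|)) :
    HasBernsteinBound (A + B) B f := by
  refine ⟨hd, fun z => ?_⟩
  have hBz : 0 ≤ B * |z.im| := by positivity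
  rcases le_total 1 |z.im| with hz | hz
  · exact (h z hz).trans (Real.exp_le_exp.2 (by linarith))
  obtain ⟨N, hN⟩ := hf
  suffices hstrip : ‖f z‖ ≤ Real.exp (A + B) from
    hstrip.trans (Real.exp_le_exp.2 (by linarith))
  refine PhragmenLindelof.horizontal_strip (a := -1) (b := 1) hd.diffContOnCl
    ⟨1, by linarith [Real.pi_gt_three], N, hN.trans (Asymptotics.IsBigO.of_norm_le fun z => ?_)⟩
    (fun w hw => ?_) (fun w hw => ?_) (abs_le.1 hz).1 (abs_le.1 hz).2
  · rw [Real.norm_of_nonneg (Real.exp_pos _).le, one_mul]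
    gcongr
    linarith [Real.add_one_le_exp |z.re|]
  · simpa [hw] using h w (by simp [hw])
  · simpa [hw] using h w (by simp [hw])

end HasStripGrowth

/-! ### Generating functions -/

/-- The point of the right half-plane obtained from `z` by folding along the real line and
rotating. -/
def foldRight (z : ℂ) : ℂ := ⟨|z.im|, -z.re⟩

/-- The distance from `z` to whichever of `w` and `conj w` lies across the real line from `z`. -/
noncomputable def reflDist (z w : ℂ) : ℝ := ‖foldRight z + conj (foldRight w)‖

theorem reflDist_sq (z w : ℂ) :
    reflDist z w ^ 2 = (|z.im| + |w.im|) ^ 2 + (z.re - w.re) ^ 2 := by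
  rw [reflDist, Complex.sq_norm, normSq_apply]
  simp only [foldRight, add_re, conj_re, add_im, conj_im, neg_neg]
  ring

theorem norm_sub_sq (z w : ℂ) : ‖z - w‖ ^ 2 = (z.im - w.im) ^ 2 + (z.re - w.re) ^ 2 := by
  rw [Complex.sq_norm, normSq_apply, sub_re, sub_im]
  ring

theorem reflDist_nonneg (z w : ℂ) : 0 ≤ reflDist z w := norm_nonneg _

theorem reflDist_pos {z : ℂ} (hz : z.im ≠ 0) (w : ℂ) : 0 < reflDist z w := by
  have := abs_pos.2 hz
  refine lt_of_le_of_ne (reflDist_nonneg z w) fun h => ?_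
  have hsq := reflDist_sq z w
  rw [← h] at hsq
  nlinarith [abs_nonneg w.im, sq_nonneg (z.re - w.re)]

theorem norm_sub_le_reflDist (z w : ℂ) : ‖z - w‖ ≤ reflDist z w := by
  refine le_of_sq_le_sq ?_ (reflDist_nonneg z w)
  rw [norm_sub_sq, reflDist_sq, ← sq_abs (z.im - w.im)]
  gcongr
  exact abs_sub _ _

theorem norm_sub_ofReal (z : ℂ) (t : ℝ) : ‖z - t‖ = ‖foldRight z + t * I‖ := by
  rw [← sq_eq_sq₀ (norm_nonneg _) (norm_nonneg _), norm_sub_sq, Complex.sq_norm, normSq_apply]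
  simp [foldRight]
  ring

theorem arg_eq_arctan {w : ℂ} (hw : 0 < w.re) : arg w = Real.arctan (w.im / w.re) := by
  have hlt := abs_lt.1 (abs_arg_lt_pi_div_two_iff.2 (Or.inl hw))
  rw [← tan_arg, Real.arctan_tan hlt.1 hlt.2]

theorem arg_ofReal_mul_I {t : ℝ} (ht : t ≠ 0) :
    arg (t * I) = if 0 < t then Real.pi / 2 else -(Real.pi / 2) := by
  split_ifs with h
  · rw [arg_real_mul _ h, arg_I]
  · have hneg : 0 < -t := neg_pos.2 (lt_of_le_of_ne (not_lt.1 h) ht)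
    rw [← neg_mul_neg, ← ofReal_neg, arg_real_mul _ hneg, arg_neg_I]

theorem sin_ofReal_mul_ne_zero {M : ℝ} (hM : M ≠ 0) {v : ℂ} (hv : v.im ≠ 0) :
    Complex.sin (M * v) ≠ 0 := fun h => by
  obtain ⟨k, hk⟩ := Complex.sin_eq_zero_iff.1 h
  have him := congrArg im hk
  rw [im_ofReal_mul, ← ofReal_intCast, ← ofReal_mul, ofReal_im] at him
  exact mul_ne_zero hM hv him

section GeneratingFunction

variable {s : Finset ℂ}

theorem logQuotient_foldRight_im {κ : Type*} {J : Finset κ} {γ : κ → ℝ}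
    (hs : ∀ w ∈ s, w.im ≠ 0) {x : ℝ} (hx : ∀ j ∈ J, γ j ≠ -x) :
    (logQuotient s (fun w => conj (foldRight w)) J γ (x * I)).im =
      angleSum s (-x) - ∑ j ∈ J, (if -x < γ j then Real.pi / 2 else -(Real.pi / 2)) := by
  rw [logQuotient_im, angleSum]
  congr 1
  · refine Finset.sum_congr rfl fun w hw => ?_
    rw [arg_eq_arctan (by simpa [foldRight] using hs w hw)]
    congr 2 <;> simp [foldRight]
    ring
  · refine Finset.sum_congr rfl fun j hj => ?_
    rw [← add_mul, ← ofReal_add, arg_ofReal_mul_I fun h => hx j hj (by linarith)]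
    simp only [neg_lt_iff_pos_add']

theorem prod_reflDist_div_le {κ : Type*} {J : Finset κ} {γ : κ → ℝ} (hs : ∀ w ∈ s, w.im ≠ 0)
    (hJ : ∀ x, |angleSum s x - ∑ j ∈ J,
      (if x < γ j then Real.pi / 2 else -(Real.pi / 2))| ≤ 2 * Real.pi)
    {z v : ℂ} (hz : z.im ≠ 0) (hv : v.im ≠ 0) :
    (∏ w ∈ s, reflDist z w) / ∏ j ∈ J, ‖z - γ j‖ ≤
      (∏ w ∈ s, reflDist v w) / (∏ j ∈ J, ‖v - γ j‖) *
        (reflDist z v ^ 2 / (|z.im| * |v.im|)) ^ 8 := by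
  have hp : ∀ w ∈ s, 0 < (conj (foldRight w)).re := fun w hw => by
    simpa [foldRight] using hs w hw
  have hz' : 0 < (foldRight z).re := abs_pos.2 hz
  have hv' : 0 < (foldRight v).re := abs_pos.2 hv
  have hle := norm_exp_le_of_abs_im_le (differentiableOn_logQuotient (J := J) (γ := γ) hp)
    (fun ζ hζ => abs_logQuotient_im_le_of_boundary hp (fun x hx => by
      rw [logQuotient_foldRight_im hs hx]
      exact hJ (-x)) hζ) hz' hv'
  rw [norm_exp_logQuotient hp hz', norm_exp_logQuotient hp hv'] at hle
  simp only [norm_sub_ofReal]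
  exact hle

theorem exists_sin_eq_mul_prod_sub {M : ℝ} (hM0 : 0 < M) (J : Finset ℤ) :
    ∃ R : ℂ → ℂ, Differentiable ℂ R ∧ HasStripGrowth R ∧
      ∀ z, Complex.sin (M * z) = R z * ∏ k ∈ J, (z - (k * (Real.pi / M) : ℝ)) := by
  have hMC : (M : ℂ) ≠ 0 := ofReal_ne_zero.2 hM0.ne'
  have hinj : Function.Injective fun k : ℤ => ((k * (Real.pi / M) : ℝ) : ℂ) :=
    ofReal_injective.comp ((mul_left_injective₀ (by positivity)).comp Int.cast_injective)
  obtain ⟨R, hR, hsin⟩ := exists_eq_mul_prod_sub (s := J) hinj.injOn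
    (f := fun z => Complex.sin (M * z)) (by fun_prop) (fun k _ => by
      rw [Complex.sin_eq_zero_iff]
      exact ⟨k, by push_cast; field_simp⟩)
  refine ⟨R, hR, .of_mul_prod_sub (J := J) (a := fun k => ((k * (Real.pi / M) : ℝ) : ℂ)) ?_, hsin⟩
  refine .of_exp_im (A := 1) hM0.le fun z => ?_
  rw [← hsin]
  simpa [abs_mul, abs_of_pos hM0] using norm_sin_le (M * z)

theorem exists_generating_function {M : ℝ} (hs : ∀ w ∈ s, w.im ≠ 0) (hM0 : 0 < M)
    (hM : ∀ x, balayage s x ≤ M) :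
    ∃ E : ℂ → ℂ, Differentiable ℂ E ∧ HasStripGrowth E ∧ (∀ w ∈ s, E w = 0) ∧
      (∀ v : ℂ, v.im ≠ 0 → v ∉ s → E v ≠ 0) ∧
      ∀ z v : ℂ, z.im ≠ 0 → v.im ≠ 0 →
        ‖E z‖ * (‖Complex.sin (M * v)‖ * ∏ w ∈ s, (‖v - w‖ / reflDist v w)) ≤
          ‖E v‖ * ‖Complex.sin (M * z)‖ * (reflDist z v ^ 2 / (|z.im| * |v.im|)) ^ 8 := by
  obtain ⟨J, hJ⟩ := exists_finset_abs_angleSum_sub_le hs hM0 hM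
  set γ : ℤ → ℝ := fun k => k * (Real.pi / M)
  obtain ⟨R, hR, hRgrowth, (hsin : ∀ z, Complex.sin (M * z) = R z * ∏ k ∈ J, (z - γ k))⟩ :=
    exists_sin_eq_mul_prod_sub hM0 J
  have hnorm : ∀ z : ℂ, z.im ≠ 0 → ‖R z * ∏ w ∈ s, (z - w)‖ =
      ‖Complex.sin (M * z)‖ * ((∏ w ∈ s, ‖z - w‖) / ∏ k ∈ J, ‖z - γ k‖) := fun z hz => by
    have hne : ∏ k ∈ J, ‖z - γ k‖ ≠ 0 := Finset.prod_ne_zero_iff.2 fun k _ h => hz (by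
      simpa using congrArg im (norm_eq_zero.1 h))
    rw [hsin z, norm_mul, norm_mul, norm_prod, norm_prod]
    field_simp
  refine ⟨fun z => R z * ∏ w ∈ s, (z - w), by fun_prop,
    hRgrowth.mul (.prod s fun w _ => .sub_const w),
    fun w hw => mul_eq_zero_of_right _ (Finset.prod_eq_zero hw (sub_self w)),
    fun v hv hvs => mul_ne_zero (fun h => sin_ofReal_mul_ne_zero hM0.ne' hv ?_)
      (Finset.prod_ne_zero_iff.2 fun w hw h => hvs (sub_eq_zero.1 h ▸ hw)), fun z v hz hv => ?_⟩
  · rw [hsin v, h, zero_mul]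
  have hprod : ∏ w ∈ s, ‖v - w‖ =
      (∏ w ∈ s, (‖v - w‖ / reflDist v w)) * ∏ w ∈ s, reflDist v w := by
    rw [← Finset.prod_mul_distrib]
    exact Finset.prod_congr rfl fun w _ => (div_mul_cancel₀ _ (reflDist_pos hv w).ne').symm
  have hb : 0 ≤ ∏ w ∈ s, (‖v - w‖ / reflDist v w) :=
    Finset.prod_nonneg fun w _ => div_nonneg (norm_nonneg _) (reflDist_nonneg v w)
  have hle : (∏ w ∈ s, ‖z - w‖) / ∏ k ∈ J, ‖z - γ k‖ ≤
      (∏ w ∈ s, reflDist z w) / ∏ k ∈ J, ‖z - γ k‖ := by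
    gcongr with w
    exact norm_sub_le_reflDist z w
  simp only [hnorm z hz, hnorm v hv, hprod]
  calc _ ≤ ‖Complex.sin (M * z)‖ * ((∏ w ∈ s, reflDist v w) / (∏ k ∈ J, ‖v - γ k‖) *
          (reflDist z v ^ 2 / (|z.im| * |v.im|)) ^ 8) *
        (‖Complex.sin (M * v)‖ * ∏ w ∈ s, (‖v - w‖ / reflDist v w)) := by
        gcongr
        exact hle.trans (prod_reflDist_div_le hs hJ hz hv)
    _ = _ := by ring

end GeneratingFunction

/-! ### Sufficiency of the two conditions -/

section BlaschkeProduct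

variable {v w : ℂ}

theorem norm_ofReal_re_sub_le (v w : ℂ) : ‖(v.re : ℂ) - w‖ ≤ ‖v - w‖ + |v.im| := by
  have hsplit : (v.re : ℂ) - w = (v - w) - v.im * I := by
    nth_rewrite 2 [← re_add_im v]; ring
  rw [hsplit]
  exact (norm_sub_le _ _).trans (by simp)

theorem log_reflDist_div_le_of_near (hv : v.im ≠ 0) (hne : w ≠ v) (hnear : ‖v - w‖ ≤ |v.im| / 2) :
    Real.log (reflDist v w / ‖v - w‖) ≤ 18 * |v.im| * (|w.im| / ‖(v.re : ℂ) - w‖ ^ 2) +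
      Real.log (|v.im| / ‖v - w‖) := by
  have hr : 0 < |v.im| := abs_pos.2 hv
  have hd : 0 < ‖v - w‖ := norm_pos_iff.2 (sub_ne_zero.2 hne.symm)
  have hR : 0 < reflDist v w := reflDist_pos hv w
  have hre : |v.re - w.re| ≤ |v.im| / 2 := (abs_re_le_norm (v - w)).trans hnear
  have him : |v.im - w.im| ≤ |v.im| / 2 := (abs_im_le_norm (v - w)).trans hnear
  have hlow : |v.im| / 2 ≤ |w.im| := by linarith [abs_sub_abs_le_abs_sub v.im w.im]
  have hup : |w.im| ≤ 3 / 2 * |v.im| := by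
    rw [abs_sub_comm] at him
    linarith [abs_sub_abs_le_abs_sub w.im v.im]
  have hRle : reflDist v w ≤ 3 * |v.im| := by
    refine le_of_sq_le_sq ?_ (by positivity)
    rw [reflDist_sq, ← sq_abs (v.re - w.re)]
    nlinarith [abs_nonneg (v.re - w.re)]
  have hlog3 : Real.log 3 ≤ 2 := by
    linarith [Real.log_le_sub_one_of_pos (show (0 : ℝ) < 3 by norm_num)]
  have hpoisson : 2 ≤ 18 * |v.im| * (|w.im| / ‖(v.re : ℂ) - w‖ ^ 2) := by
    have hx0 : 0 < ‖(v.re : ℂ) - w‖ ^ 2 := by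
      rw [norm_ofReal_sub_sq, ← sq_abs w.im]
      have : 0 < |w.im| := by linarith
      positivity
    have hx : ‖(v.re : ℂ) - w‖ ^ 2 ≤ (3 / 2 * |v.im|) ^ 2 := by
      gcongr
      linarith [norm_ofReal_re_sub_le v w]
    rw [← mul_div_assoc, le_div_iff₀ hx0]
    nlinarith
  calc Real.log (reflDist v w / ‖v - w‖) ≤ Real.log (3 * (|v.im| / ‖v - w‖)) := by
        rw [← mul_div_assoc]
        gcongr
    _ = Real.log 3 + Real.log (|v.im| / ‖v - w‖) := Real.log_mul (by norm_num) (by positivity)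
    _ ≤ _ := by linarith

theorem log_reflDist_div_le_of_far (hv : v.im ≠ 0) (hw : w.im ≠ 0)
    (hfar : |v.im| / 2 ≤ ‖v - w‖) :
    Real.log (reflDist v w / ‖v - w‖) ≤ 18 * |v.im| * (|w.im| / ‖(v.re : ℂ) - w‖ ^ 2) := by
  have hr : 0 < |v.im| := abs_pos.2 hv
  have hb : 0 < |w.im| := abs_pos.2 hw
  have hd : 0 < ‖v - w‖ := by linarith
  have hR : 0 < reflDist v w := reflDist_pos hv w
  have hx0 : 0 < ‖(v.re : ℂ) - w‖ ^ 2 := by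
    rw [norm_ofReal_sub_sq, ← sq_abs w.im]
    positivity
  have hlog : 2 * Real.log (reflDist v w / ‖v - w‖) ≤ reflDist v w ^ 2 / ‖v - w‖ ^ 2 - 1 := by
    rw [← div_pow, ← Nat.cast_ofNat, ← Real.log_pow]
    exact Real.log_le_sub_one_of_pos (by positivity)
  have hdiff : reflDist v w ^ 2 - ‖v - w‖ ^ 2 ≤ 4 * |v.im| * |w.im| := by
    rw [reflDist_sq, norm_sub_sq]
    have : v.im * w.im ≤ |v.im| * |w.im| := (le_abs_self _).trans (abs_mul _ _).le
    nlinarith [sq_abs v.im, sq_abs w.im]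
  have hx : ‖(v.re : ℂ) - w‖ ^ 2 ≤ (3 * ‖v - w‖) ^ 2 := by
    gcongr
    linarith [norm_ofReal_re_sub_le v w]
  have hcompare : 4 * |v.im| * |w.im| / ‖v - w‖ ^ 2 ≤
      36 * |v.im| * (|w.im| / ‖(v.re : ℂ) - w‖ ^ 2) := by
    rw [← mul_div_assoc, div_le_div_iff₀ (by positivity) hx0]
    have : 0 < |v.im| * |w.im| := mul_pos hr hb
    nlinarith
  have : reflDist v w ^ 2 / ‖v - w‖ ^ 2 - 1 ≤ 4 * |v.im| * |w.im| / ‖v - w‖ ^ 2 := by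
    rw [div_sub_one (by positivity)]
    gcongr
  linarith

theorem log_reflDist_div_le (hv : v.im ≠ 0) (hw : w.im ≠ 0) (hne : w ≠ v) :
    Real.log (reflDist v w / ‖v - w‖) ≤ 18 * |v.im| * (|w.im| / ‖(v.re : ℂ) - w‖ ^ 2) +
      if dist w v ≤ |v.im| then Real.log (|v.im| / dist w v) else 0 := by
  have hd : 0 < ‖v - w‖ := norm_pos_iff.2 (sub_ne_zero.2 hne.symm)
  rw [dist_comm, dist_eq_norm]
  rcases le_total ‖v - w‖ (|v.im| / 2) with hnear | hfar
  · rw [if_pos (by linarith [abs_nonneg v.im])]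
    exact log_reflDist_div_le_of_near hv hne hnear
  · refine le_add_of_le_of_nonneg (log_reflDist_div_le_of_far hv hw hfar) ?_
    split_ifs with h
    · exact Real.log_nonneg ((one_le_div hd).2 h)
    · exact le_rfl

theorem exp_mul_le_prod_div_reflDist {Λ : Set ℂ} (hΛ : IsDiscreteSeq Λ)
    (hreal : ∀ l ∈ Λ, l.im ≠ 0) {C M : ℝ} {l : ℂ} (hl : l ∈ Λ)
    (hC : integratedCountingFn Λ l |l.im| ≤ C * |l.im|) {s : Finset ℂ} (hs : ∀ w ∈ s, w ∈ Λ)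
    (hls : l ∉ s) (hM : balayage s l.re ≤ M) :
    Real.exp (-((18 * M + C) * |l.im|)) * |l.im| ≤ ∏ w ∈ s, (‖l - w‖ / reflDist l w) := by
  have hr : 0 < |l.im| := abs_pos.2 (hreal l hl)
  have hne : ∀ w ∈ s, w ≠ l := fun w hw h => hls (h ▸ hw)
  have hfactor : ∀ w ∈ s, 0 < ‖l - w‖ / reflDist l w := fun w hw =>
    div_pos (norm_pos_iff.2 (sub_ne_zero.2 (hne w hw).symm)) (reflDist_pos (hreal l hl) w)
  have hnear : ∑ w ∈ s, (if dist w l ≤ |l.im| then Real.log (|l.im| / dist w l) else 0) ≤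
      ∑ w ∈ neighbours hΛ l |l.im|, Real.log (|l.im| / dist w l) := by
    rw [← Finset.sum_filter]
    refine Finset.sum_le_sum_of_subset_of_nonneg (fun w hw => ?_) fun w hw _ => ?_
    · rw [Finset.mem_filter] at hw
      exact (mem_neighbours hΛ).2 ⟨hne w hw.1, hs w hw.1, hw.2⟩
    · obtain ⟨hwl, -, hdist⟩ := (mem_neighbours hΛ).1 hw
      exact Real.log_nonneg ((one_le_div (dist_pos.2 hwl)).2 hdist)
  rw [integratedCountingFn_eq_sum_log hΛ hl hr] at hC
  have hsum : ∑ w ∈ s, Real.log (reflDist l w / ‖l - w‖) ≤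
      (18 * M + C) * |l.im| - Real.log |l.im| :=
    calc _ ≤ 18 * |l.im| * balayage s l.re +
          ∑ w ∈ s, (if dist w l ≤ |l.im| then Real.log (|l.im| / dist w l) else 0) := by
          rw [balayage, Finset.mul_sum, ← Finset.sum_add_distrib]
          exact Finset.sum_le_sum fun w hw =>
            log_reflDist_div_le (hreal l hl) (hreal w (hs w hw)) (hne w hw)
      _ ≤ 18 * |l.im| * M + (C * |l.im| - Real.log |l.im|) := by
          gcongr
          linarith
      _ = _ := by ring
  have hinv : ∀ w ∈ s, Real.log (‖l - w‖ / reflDist l w) =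
      -Real.log (reflDist l w / ‖l - w‖) := fun w _ => by rw [← Real.log_inv, inv_div]
  rw [← Real.log_le_log_iff (by positivity) (Finset.prod_pos hfactor),
    Real.log_mul (Real.exp_pos _).ne' hr.ne', Real.log_exp,
    Real.log_prod fun w hw => (hfactor w hw).ne', Finset.sum_congr rfl hinv,
    Finset.sum_neg_distrib]
  linarith

end BlaschkeProduct

section PeakFunction

theorem abs_im_le_norm_sin (w : ℂ) : |w.im| ≤ ‖Complex.sin w‖ := by
  have hneg : ‖Complex.exp (-w * I)‖ = Real.exp w.im := by rw [Complex.norm_exp]; simp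
  have hpos : ‖Complex.exp (w * I)‖ = Real.exp (-w.im) := by rw [Complex.norm_exp]; simp
  have hsub := abs_norm_sub_norm_le (Complex.exp (-w * I)) (Complex.exp (w * I))
  rw [hneg, hpos] at hsub
  rw [Complex.sin, norm_div, norm_mul, norm_I, mul_one, Complex.norm_ofNat, le_div_iff₀ two_pos]
  refine le_trans ?_ hsub
  have hsinh := Real.self_le_sinh_iff.2 (abs_nonneg w.im)
  rw [← Real.abs_sinh, Real.sinh_eq, abs_div, abs_two] at hsinh
  linarith

theorem one_add_sq_le_two_mul_exp {t : ℝ} (ht : 0 ≤ t) : 1 + t ^ 2 ≤ 2 * Real.exp t := by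
  linarith [Real.quadratic_le_exp_of_nonneg ht]

variable {M : ℝ} {w : ℂ}

theorem reflDist_sq_div_le {z : ℂ} (hz : 1 ≤ |z.im|) (hM : 1 ≤ M * |w.im|) :
    reflDist z w ^ 2 / (|z.im| * |w.im|) ≤
      2 * M * (1 + (z.re - w.re) ^ 2) * Real.exp (|z.im| + |w.im|) := by
  have hw : 0 < |w.im| := lt_of_le_of_ne (abs_nonneg _) fun h => by
    rw [← h, mul_zero] at hM
    linarith
  have hsum : 0 ≤ |z.im| + |w.im| := by positivity
  have hyr : 1 ≤ M * (|z.im| * |w.im|) := by nlinarith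
  rw [div_le_iff₀ (by positivity)]
  calc reflDist z w ^ 2 ≤ (1 + (z.re - w.re) ^ 2) * (1 + (|z.im| + |w.im|) ^ 2) := by
        rw [reflDist_sq]
        nlinarith [mul_nonneg (sq_nonneg (z.re - w.re)) (sq_nonneg (|z.im| + |w.im|))]
    _ ≤ (1 + (z.re - w.re) ^ 2) * (2 * Real.exp (|z.im| + |w.im|)) := by
        gcongr
        exact one_add_sq_le_two_mul_exp hsum
    _ ≤ (1 + (z.re - w.re) ^ 2) * (2 * Real.exp (|z.im| + |w.im|)) *
          (M * (|z.im| * |w.im|)) := le_mul_of_one_le_right (by positivity) hyr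
    _ = _ := by ring

theorem norm_csinc_sub_sq_mul_le (z w : ℂ) :
    ‖csinc (z - w)‖ ^ 2 * (1 + (z.re - w.re) ^ 2) ≤ 4 * Real.exp (2 * (|z.im| + |w.im|)) := by
  have him : |(z - w).im| ≤ |z.im| + |w.im| := by rw [sub_im]; exact abs_sub _ _
  have hre : (z.re - w.re) ^ 2 ≤ ‖z - w‖ ^ 2 := by
    rw [norm_sub_sq]
    exact le_add_of_nonneg_left (sq_nonneg _)
  have hX : 1 + (z.re - w.re) ^ 2 ≤ (1 + ‖z - w‖) ^ 2 := by nlinarith [norm_nonneg (z - w)]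
  calc _ ≤ ‖csinc (z - w)‖ ^ 2 * (1 + ‖z - w‖) ^ 2 := by gcongr
    _ = (‖csinc (z - w)‖ * (1 + ‖z - w‖)) ^ 2 := by ring
    _ ≤ (2 * Real.exp (|z.im| + |w.im|)) ^ 2 := pow_le_pow_left₀ (by positivity)
        ((norm_csinc_mul_one_add_le _).trans (by gcongr)) 2
    _ = _ := by
        rw [mul_pow, ← Real.exp_nat_mul]
        norm_num

theorem one_le_mul_abs_im_of_balayage_le {T : Finset ℂ} (hwT : w ∈ T) (hw : w.im ≠ 0)
    (hM : balayage T w.re ≤ M) : 1 ≤ M * |w.im| := by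
  have hb : 0 < |w.im| := abs_pos.2 hw
  have hsingle : |w.im| / ‖(w.re : ℂ) - w‖ ^ 2 ≤ M :=
    (Finset.single_le_sum (f := fun w : ℂ => |w.im| / ‖(_ : ℂ) - w‖ ^ 2)
      (fun _ _ => by positivity) hwT).trans hM
  rw [norm_ofReal_sub_sq, sub_self, zero_pow two_ne_zero, zero_add, ← sq_abs,
    div_le_iff₀ (by positivity)] at hsingle
  nlinarith

theorem exp_neg_div_le (x : ℝ) (hM : 1 ≤ M * |w.im|) :
    Real.exp (-|w.im|) / (1 + (x - w.re) ^ 2) ≤ 2 * M * (|w.im| / ‖(x : ℂ) - w‖ ^ 2) := by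
  have hw : 0 < |w.im| := lt_of_le_of_ne (abs_nonneg _) fun h => by
    rw [← h, mul_zero] at hM
    linarith
  have hnorm := norm_ofReal_sub_sq x w
  rw [← sq_abs w.im] at hnorm
  have hN : 0 < ‖(x : ℂ) - w‖ ^ 2 := by rw [hnorm]; positivity
  rw [← mul_div_assoc, div_le_div_iff₀ (by positivity) hN]
  calc Real.exp (-|w.im|) * ‖(x : ℂ) - w‖ ^ 2
      ≤ Real.exp (-|w.im|) * ((1 + (x - w.re) ^ 2) * (1 + |w.im| ^ 2)) := by
        gcongr
        rw [hnorm]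
        nlinarith [mul_nonneg (sq_nonneg (x - w.re)) (sq_nonneg |w.im|)]
    _ ≤ Real.exp (-|w.im|) * ((1 + (x - w.re) ^ 2) * (2 * Real.exp |w.im|)) := by
        gcongr
        exact one_add_sq_le_two_mul_exp hw.le
    _ = 2 * 1 * (1 + (x - w.re) ^ 2) := by
        rw [Real.exp_neg]
        field_simp
    _ ≤ 2 * (M * |w.im|) * (1 + (x - w.re) ^ 2) := by gcongr
    _ = _ := by ring

theorem norm_exp_sign_le {k : ℝ} (hk : 0 ≤ k) (z l : ℂ) :
    ‖Complex.exp (-((k * SignType.sign l.im : ℝ) * I * (z - l)))‖ ≤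
      Real.exp (k * |z.im| - k * |l.im|) := by
  have hre (a : ℝ) : (-((k * a : ℝ) * I * (z - l))).re = k * (a * z.im) - k * (a * l.im) := by
    simp only [neg_re, mul_re, mul_im, ofReal_re, ofReal_im, I_re, I_im, sub_re, sub_im]
    ring
  rw [Complex.norm_exp, hre, sign_mul_self]
  have hsign : (SignType.sign l.im : ℝ) * z.im ≤ |z.im| := by
    rcases SignType.sign l.im with _ | _ | _ <;> simp [neg_le_abs, le_abs_self]
  gcongr

variable {Λ : Set ℂ} (hΛ : IsDiscreteSeq Λ) (hreal : ∀ l ∈ Λ, l.im ≠ 0) {C : ℝ} {T : Finset ℂ}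
  (hT : ∀ w ∈ T, w ∈ Λ) (hM : ∀ x, balayage T x ≤ M) {l : ℂ} (hl : l ∈ T)
  (hC : integratedCountingFn Λ l |l.im| ≤ C * |l.im|)

include hΛ hreal hT hM hl hC

theorem exp_neg_div_le_norm_sin_mul_prod :
    Real.exp (-((18 * M + C) * |l.im|)) / M ≤
      ‖Complex.sin (M * l)‖ * ∏ w ∈ T.erase l, (‖l - w‖ / reflDist l w) := by
  have hlim := hreal l (hT l hl)
  have hMl : 1 ≤ M * |l.im| := one_le_mul_abs_im_of_balayage_le hl hlim (hM l.re)
  have hM0 : 0 < M := pos_of_mul_pos_left (by linarith) (abs_nonneg _)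
  have hsin : M * |l.im| ≤ ‖Complex.sin (M * l)‖ := by
    simpa [abs_mul, abs_of_pos hM0] using abs_im_le_norm_sin (M * l)
  have hprod : Real.exp (-((18 * M + C) * |l.im|)) * |l.im| ≤
      ∏ w ∈ T.erase l, (‖l - w‖ / reflDist l w) :=
    exp_mul_le_prod_div_reflDist hΛ hreal (hT l hl) hC
      (fun w hw => hT w (Finset.mem_of_mem_erase hw)) (Finset.notMem_erase l T)
      ((balayage_mono (T.erase_subset l) _).trans (hM _))
  rw [div_le_iff₀ hM0]
  calc Real.exp (-((18 * M + C) * |l.im|))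
      ≤ Real.exp (-((18 * M + C) * |l.im|)) * (M * |l.im|) :=
        le_mul_of_one_le_right (Real.exp_pos _).le hMl
    _ = 1 * (Real.exp (-((18 * M + C) * |l.im|)) * |l.im|) * M := by ring
    _ ≤ _ := by
        gcongr
        exact hMl.trans hsin

theorem exists_normalised_generating_function :
    ∃ E : ℂ → ℂ, Differentiable ℂ E ∧ HasStripGrowth E ∧ E l = 1 ∧
      (∀ w ∈ T, w ≠ l → E w = 0) ∧ ∀ z : ℂ, 1 ≤ |z.im| →
        ‖E z‖ ≤ 2 ^ 8 * M ^ 9 * (1 + (z.re - l.re) ^ 2) ^ 8 *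
          Real.exp ((M + 8) * |z.im| + (18 * M + C + 8) * |l.im|) := by
  classical
  have hlim := hreal l (hT l hl)
  have hr : 0 < |l.im| := abs_pos.2 hlim
  have hMl : 1 ≤ M * |l.im| := one_le_mul_abs_im_of_balayage_le hl hlim (hM l.re)
  have hM0 : 0 < M := pos_of_mul_pos_left (by linarith) hr.le
  have hM' : ∀ x, balayage (T.erase l) x ≤ M := fun x =>
    (balayage_mono (T.erase_subset l) x).trans (hM x)
  have hTe : ∀ w ∈ T.erase l, w ∈ Λ := fun w hw => hT w (Finset.mem_of_mem_erase hw)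
  have hlT := Finset.notMem_erase l T
  obtain ⟨E, hE, hEgrowth, hE0, hEne, hEle⟩ :=
    exists_generating_function (fun w hw => hreal w (hTe w hw)) hM0 hM'
  have hEl := norm_pos_iff.2 (hEne l hlim hlT)
  refine ⟨fun z => E z * (E l)⁻¹, by fun_prop, hEgrowth.mul (.const _),
    mul_inv_cancel₀ (hEne l hlim hlT), fun w hw hwl => by
      simp [hE0 w (Finset.mem_erase.2 ⟨hwl, hw⟩)], fun z hz => ?_⟩
  have hz0 : z.im ≠ 0 := abs_pos.1 (by linarith)
  have hlow := exp_neg_div_le_norm_sin_mul_prod hΛ hreal hT hM hl hC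
  have hsin : ‖Complex.sin (M * z)‖ ≤ Real.exp (M * |z.im|) := by
    simpa [abs_mul, abs_of_pos hM0] using norm_sin_le (M * z)
  have hle : ‖E z‖ * (Real.exp (-((18 * M + C) * |l.im|)) / M) ≤
      ‖E l‖ * Real.exp (M * |z.im|) *
        (2 * M * (1 + (z.re - l.re) ^ 2) * Real.exp (|z.im| + |l.im|)) ^ 8 := by
    refine (mul_le_mul_of_nonneg_left hlow (norm_nonneg _)).trans ((hEle z l hz0 hlim).trans ?_)
    gcongr
    exact reflDist_sq_div_le hz hMl
  rw [← mul_div_assoc, div_le_iff₀ hM0, Real.exp_neg, ← div_eq_mul_inv,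
    div_le_iff₀ (Real.exp_pos _)] at hle
  rw [norm_mul, norm_inv, ← div_eq_mul_inv, div_le_iff₀ hEl]
  refine hle.trans_eq ?_
  have hexp : Real.exp ((M + 8) * |z.im| + (18 * M + C + 8) * |l.im|) =
      Real.exp (M * |z.im|) * Real.exp (|z.im| + |l.im|) ^ 8 *
        Real.exp ((18 * M + C) * |l.im|) := by
    rw [← Real.exp_nat_mul, ← Real.exp_add, ← Real.exp_add]
    push_cast
    ring_nf
  rw [hexp]
  ring

theorem exists_peak_function :
    ∃ F : ℂ → ℂ, Differentiable ℂ F ∧ HasStripGrowth F ∧ F l = 1 ∧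
      (∀ w ∈ T, w ≠ l → F w = 0) ∧ ∀ z : ℂ, 1 ≤ |z.im| →
        ‖F z‖ * (1 + (z.re - l.re) ^ 2) ≤ 2 ^ 26 * M ^ 9 *
          Real.exp ((M + 26) * |z.im| + (18 * M + C + 26) * |l.im|) := by
  obtain ⟨E, hE, hEgrowth, hEl, hE0, hEle⟩ :=
    exists_normalised_generating_function hΛ hreal hT hM hl hC
  have hM0 : 0 ≤ M := (balayage_nonneg T 0).trans (hM 0)
  refine ⟨fun z => E z * csinc (z - l) ^ 18, ?_, hEgrowth.mul ?_, by simp [csinc_zero, hEl],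
    fun w hw hwl => by simp [hE0 w hw hwl], fun z hz => ?_⟩
  · exact hE.mul ((differentiable_csinc.comp (by fun_prop)).pow 18)
  · refine .of_exp_im (A := Real.exp (18 * |l.im|)) (B := 18) (by norm_num) fun z => ?_
    rw [norm_pow, ← Real.exp_add, ← mul_add]
    refine (pow_le_pow_left₀ (norm_nonneg _) (norm_csinc_le _) 18).trans ?_
    rw [← Real.exp_nat_mul, Nat.cast_ofNat, sub_im, add_comm |l.im|]
    gcongr
    exact abs_sub _ _
  · rw [norm_mul, norm_pow]
    have hexp : Real.exp ((M + 26) * |z.im| + (18 * M + C + 26) * |l.im|) =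
        Real.exp ((M + 8) * |z.im| + (18 * M + C + 8) * |l.im|) *
          Real.exp (2 * (|z.im| + |l.im|)) ^ 9 := by
      rw [← Real.exp_nat_mul, ← Real.exp_add]
      push_cast
      ring_nf
    set X := 1 + (z.re - l.re) ^ 2
    calc ‖E z‖ * ‖csinc (z - l)‖ ^ 18 * X
        ≤ 2 ^ 8 * M ^ 9 * X ^ 8 * Real.exp ((M + 8) * |z.im| + (18 * M + C + 8) * |l.im|) *
            ‖csinc (z - l)‖ ^ 18 * X := by
          gcongr
          exact hEle z hz
      _ = 2 ^ 8 * M ^ 9 * Real.exp ((M + 8) * |z.im| + (18 * M + C + 8) * |l.im|) *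
            (‖csinc (z - l)‖ ^ 2 * X) ^ 9 := by ring
      _ ≤ 2 ^ 8 * M ^ 9 * Real.exp ((M + 8) * |z.im| + (18 * M + C + 8) * |l.im|) *
            (4 * Real.exp (2 * (|z.im| + |l.im|))) ^ 9 :=
          mul_le_mul_of_nonneg_left
            (pow_le_pow_left₀ (by positivity) (norm_csinc_sub_sq_mul_le z l) 9) (by positivity)
      _ = _ := by
          rw [hexp]
          ring

theorem exists_decaying_peak_function (hC0 : 0 ≤ C) {K : ℝ} (hK : 0 ≤ K) :
    ∃ G : ℂ → ℂ, Differentiable ℂ G ∧ HasStripGrowth G ∧ G l = 1 ∧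
      (∀ w ∈ T, w ≠ l → G w = 0) ∧ ∀ z : ℂ, 1 ≤ |z.im| →
        Real.exp (K * |l.im|) * ‖G z‖ ≤ 2 ^ 27 * M ^ 10 *
          Real.exp ((K + 19 * M + C + 53) * |z.im|) * (|l.im| / ‖(z.re : ℂ) - l‖ ^ 2) := by
  obtain ⟨F, hF, hFgrowth, hFl, hF0, hFle⟩ := exists_peak_function hΛ hreal hT hM hl hC
  have hM0 : 0 ≤ M := (balayage_nonneg T 0).trans (hM 0)
  have hMl := one_le_mul_abs_im_of_balayage_le hl (hreal l (hT l hl)) (hM l.re)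
  set k := K + (18 * M + C + 26) + 1 with hk
  have hk0 : 0 ≤ k := by positivity
  refine ⟨fun z => F z * Complex.exp (-((k * SignType.sign l.im : ℝ) * I * (z - l))),
    by fun_prop, hFgrowth.mul (.of_exp_im (A := 1) hk0 fun z => ?_), by simp [hFl],
    fun w hw hwl => by simp [hF0 w hw hwl], fun z hz => ?_⟩
  · rw [one_mul]
    exact (norm_exp_sign_le hk0 z l).trans
      (Real.exp_le_exp.2 (sub_le_self _ (mul_nonneg hk0 (abs_nonneg _))))
  · have hexp : Real.exp (K * |l.im|) *
        (Real.exp ((M + 26) * |z.im| + (18 * M + C + 26) * |l.im|) *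
          Real.exp (k * |z.im| - k * |l.im|)) =
        Real.exp ((K + 19 * M + C + 53) * |z.im|) * Real.exp (-|l.im|) := by
      rw [← Real.exp_add, ← Real.exp_add, ← Real.exp_add, hk]
      ring_nf
    have hX : 0 < 1 + (z.re - l.re) ^ 2 := by positivity
    rw [norm_mul]
    calc _ ≤ Real.exp (K * |l.im|) * (2 ^ 26 * M ^ 9 *
            Real.exp ((M + 26) * |z.im| + (18 * M + C + 26) * |l.im|) /
              (1 + (z.re - l.re) ^ 2) * Real.exp (k * |z.im| - k * |l.im|)) := by
          gcongr
          · exact (le_div_iff₀ hX).2 (hFle z hz)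
          · exact norm_exp_sign_le hk0 z l
      _ = 2 ^ 26 * M ^ 9 * Real.exp ((K + 19 * M + C + 53) * |z.im|) *
            (Real.exp (-|l.im|) / (1 + (z.re - l.re) ^ 2)) := by
          linear_combination (2 ^ 26 * M ^ 9 / (1 + (z.re - l.re) ^ 2)) * hexp
      _ ≤ 2 ^ 26 * M ^ 9 * Real.exp ((K + 19 * M + C + 53) * |z.im|) *
            (2 * M * (|l.im| / ‖(z.re : ℂ) - l‖ ^ 2)) := by
          gcongr
          exact exp_neg_div_le z.re hMl
      _ = _ := by ring

end PeakFunction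

section Sufficiency

variable {Λ : Set ℂ}

theorem exists_interpolation_finset (hΛ : IsDiscreteSeq Λ) (hreal : ∀ l ∈ Λ, l.im ≠ 0) {C M : ℝ}
    (hC0 : 0 ≤ C) (hC : ∀ l ∈ Λ, integratedCountingFn Λ l |l.im| ≤ C * |l.im|) (hM0 : 0 < M)
    (hM : ∀ T : Finset ℂ, (∀ w ∈ T, w ∈ Λ) → ∀ x, balayage T x ≤ M)
    {v : ℂ → ℂ} {V K : ℝ} (hK : 0 ≤ K) (hV : 0 < V)
    (hv : ∀ w ∈ Λ, ‖v w‖ ≤ V * Real.exp (K * |w.im|)) :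
    ∃ A B : ℝ, ∀ T : Finset ℂ, (∀ w ∈ T, w ∈ Λ) →
      ∃ f, HasBernsteinBound A B f ∧ ∀ w ∈ T, f w = v w := by
  set B := K + 19 * M + C + 53
  refine ⟨Real.log (V * (2 ^ 27 * M ^ 11)) + B, B, fun T hT => ?_⟩
  have hpeak := fun l (hl : l ∈ T) =>
    exists_decaying_peak_function hΛ hreal hT (hM T hT) hl (hC l (hT l hl)) hC0 hK
  choose! G hG hGgrowth hGl hG0 hGle using hpeak
  refine ⟨fun z => ∑ l ∈ T, v l * G l z, HasStripGrowth.hasBernsteinBound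
    (.sum T fun l hl => (HasStripGrowth.const _).mul (hGgrowth l hl))
    (Differentiable.fun_sum fun l hl => (hG l hl).const_mul _) (by positivity) fun z hz => ?_,
    fun w hw => ?_⟩
  · have hterm : ∀ l ∈ T, ‖v l * G l z‖ ≤ V * (2 ^ 27 * M ^ 10 * Real.exp (B * |z.im|)) *
        (|l.im| / ‖(z.re : ℂ) - l‖ ^ 2) := fun l hl => by
      rw [norm_mul]
      calc _ ≤ V * Real.exp (K * |l.im|) * ‖G l z‖ := by
            gcongr
            exact hv l (hT l hl)
        _ = V * (Real.exp (K * |l.im|) * ‖G l z‖) := mul_assoc _ _ _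
        _ ≤ _ := mul_le_mul_of_nonneg_left (hGle l hl z hz) hV.le
        _ = _ := by ring
    rw [Real.exp_add, Real.exp_log (by positivity)]
    calc ‖∑ l ∈ T, v l * G l z‖
        ≤ V * (2 ^ 27 * M ^ 10 * Real.exp (B * |z.im|)) * balayage T z.re := by
          rw [balayage, Finset.mul_sum]
          exact norm_sum_le_of_le T hterm
      _ ≤ V * (2 ^ 27 * M ^ 10 * Real.exp (B * |z.im|)) * M := by
          gcongr
          exact hM T hT z.re
      _ = _ := by ring
  · simp only
    rw [Finset.sum_eq_single_of_mem w hw fun l hl hlw => by rw [hG0 l hl w hw hlw.symm, mul_zero],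
      hGl w hw, mul_one]

theorem CarlesonCondition.exists_balayage_le (h : CarlesonCondition Λ) :
    ∃ M : ℝ, 0 < M ∧ ∀ T : Finset ℂ, (∀ w ∈ T, w ∈ Λ) → ∀ x, balayage T x ≤ M := by
  classical
  set S : ℝ → ENNReal := fun x =>
    ∑' l : Λ, ENNReal.ofReal (|(l : ℂ).im| / ‖(x : ℂ) - (l : ℂ)‖ ^ 2)
  refine ⟨(⨆ x, S x).toReal + 1, by positivity, fun T hT x => ?_⟩
  have hle := (ENNReal.sum_le_tsum (T.subtype (· ∈ Λ))).trans (le_iSup S x)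
  rw [← ENNReal.ofReal_sum_of_nonneg fun l _ => by positivity,
    Finset.sum_subtype_of_mem (fun w : ℂ => |w.im| / ‖(x : ℂ) - w‖ ^ 2) hT,
    ENNReal.ofReal_le_iff_le_toReal h.ne] at hle
  exact hle.trans (le_add_of_nonneg_right zero_le_one)

theorem DensityCondition.isInterpolating (hΛ : IsDiscreteSeq Λ) (hreal : ∀ l ∈ Λ, l.im ≠ 0)
    (hdensity : DensityCondition Λ) (hcarleson : CarlesonCondition Λ) : IsInterpolating Λ := by
  obtain ⟨C, hC0, hC⟩ := hdensity
  obtain ⟨M, hM0, hM⟩ := hcarleson.exists_balayage_le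
  rintro v ⟨K, hK, V, hV⟩
  have hextend : ∀ l : Λ, Function.extend Subtype.val v 0 l = v l :=
    Subtype.val_injective.extend_apply v 0
  have hv : ∀ w ∈ Λ, ‖Function.extend Subtype.val v 0 w‖ ≤
      max V 1 * Real.exp (K * |w.im|) := fun w hw => by
    have hle : ‖v ⟨w, hw⟩‖ * Real.exp (-K * |w.im|) ≤ V := hV ⟨⟨w, hw⟩, rfl⟩
    rw [neg_mul, Real.exp_neg, ← div_eq_mul_inv, div_le_iff₀ (Real.exp_pos _)] at hle
    rw [hextend ⟨w, hw⟩]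
    exact hle.trans (by gcongr; exact le_max_left _ _)
  obtain ⟨A, B, hAB⟩ :=
    exists_interpolation_finset hΛ hreal hC0.le hC hM0 hM hK.le (by positivity) hv
  choose f hf hfv using fun T : Finset Λ => hAB (T.map (.subtype (· ∈ Λ)))
    fun _ hw => T.property_of_mem_map_subtype hw
  obtain ⟨g, hg, hlim⟩ := HasBernsteinBound.exists_tendsto_ultrafilter (Ultrafilter.of atTop) hf
  refine ⟨g, hg.mem_bernstein, fun l => tendsto_nhds_unique (hlim l)
    (tendsto_const_nhds.congr' ?_)⟩
  filter_upwards [Ultrafilter.of_le (atTop : Filter (Finset Λ)) (eventually_ge_atTop {l})]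
    with T hT
  have hlT : l ∈ T := hT (Finset.mem_singleton_self l)
  rw [hfv T l (Finset.mem_map_of_mem _ hlT), hextend]

end Sufficiency

end BernsteinAlgebra

/-- Geometric characterisation of interpolation sequences for the Bernstein algebra. The positive
distance to `ℝ` is used only for the necessity of the Carleson condition (which itself forces it). -/
theorem theoremB (Λ : Set ℂ) (hΛ : BernsteinAlgebra.IsDiscreteSeq Λ)
    (hreal : ∀ l ∈ Λ, l.im ≠ 0) :
    ((∃ δ > (0 : ℝ), ∀ l ∈ Λ, δ ≤ |l.im|) →
      (BernsteinAlgebra.IsInterpolating Λ ↔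
        BernsteinAlgebra.DensityCondition Λ ∧ BernsteinAlgebra.CarlesonCondition Λ)) ∧
    (BernsteinAlgebra.DensityCondition Λ ∧ BernsteinAlgebra.CarlesonCondition Λ →
      BernsteinAlgebra.IsInterpolating Λ) ∧
    (BernsteinAlgebra.IsInterpolating Λ → BernsteinAlgebra.DensityCondition Λ) := by
  have hsuff : BernsteinAlgebra.DensityCondition Λ ∧ BernsteinAlgebra.CarlesonCondition Λ →
      BernsteinAlgebra.IsInterpolating Λ := fun h =>
    h.1.isInterpolating hΛ hreal h.2
  refine ⟨?_, hsuff, fun h => h.densityCondition hΛ hreal⟩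
  rintro ⟨δ, hδ, hsep⟩
  exact ⟨fun h => ⟨h.densityCondition hΛ hreal, h.carlesonCondition hδ hsep⟩, hsuff⟩
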